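/- **Definitions.** Throughout, $[m]=\{1,\dots,m\}$ and $\deg(v)$ is the number of children of a vertex $v$ of a rooted tree; each vertex is a descendant of itself. *Polynomials.* Define $Q_n=Q_n(x,y,z,t)\in\mathbb Z[x,y,z,t]$ for $n\ge 1$ by $Q_1=1$ and $Q_{n+1}=[x+nz+(y+t)(n+y\,\partial_y)]\,Q_n$, and define $Q_{n,k}(x,t)$ by $Q_n(x,y,1,t)=\sum_{k\ge 0}Q_{n,k}(x,t)\,y^k$. *Plane trees.* Let $\mathcal O_{n+1}$ be the set of plane trees (labeled rooted trees in which the children of each vertex are linearly ordered from left to right) with vertex set $[n+1]$ and root $1$. For $T\in\mathcal O_{n+1}$ let $\beta_T(v)$ be the smallest descendant of $v$. A vertex $j$ is *elder* if it has a brother $k$ to its right with $\beta_T(k)<\beta_T(j)$. Let $\mathrm{eld}(T)$ be the number of elder vertices of $T$, and let $\mathrm{young}_T(1)$ be the number of children of the root $1$ that are not elder. An edge $(i,j)$, with $j$ a child of $i$, is *improper* if $j$ is not elder and $i\ge\beta_T(j)$. Let $\mathrm{imp}(T)$ be the number of improper edges of $T$. *Half-mobile trees.* A half-mobile tree is a rooted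 tree with white (labeled) and black (unlabeled) vertices in which each black vertex has at least two children, all of them white, the children of each black vertex carry a cyclic order, and the children of each white vertex are not ordered. Let $\mathcal H_n$ be the set of forests of half-mobile trees whose white vertices are labeled bijectively by $[n]$; since black vertices are unlabeled, forests are identified under isomorphisms that fix all white labels and preserve roots, parents and cyclic orders. For $F\in\mathcal H_n$ let $\beta_F(v)$ be the smallest white descendant of $v$; the *rightmost* child of a black vertex is its child $w$ with the smallest $\beta_F(w)$. An edge $(u,v)$, with $v$ a child of $u$, is *improper* if either $u$ and $v$ are white and $u>\beta_F(v)$, or $u$ is black, $v$ is its rightmost child and $u$ has a (white) father greater than $\beta_F(v)$. Let $\mathrm{tree}(F)$ be the number of trees of $F$, $\mathrm{imp}(F)$ the number of its improper edges, and $\mathrm{bdeg}(F)=\sum_v(\deg_F(v)-1)$, the sum over the black vertices $v$ of $F$. **Theorem.** Let $n\ge 1$. 1. There is a bijection $\theta:\mathcal O_{n+1}\to\mathcal H_n$ such that for every $T\in\mathcal O_{n+1}$ $$\mathrm{young}_T(1)=\mathrm{tree}(\theta(T)),\qquad \mathrm{eld}(T)=\mathrm{bdeg}(\theta(T)),\qquad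 \mathrm{imp}(T)=\mathrm{imp}(\theta(T)).$$ 2. For every $k\ge 0$, $$Q_{n,k}(x,t)=\sum_{F\in\mathcal H_n,\ \mathrm{imp}(F)=k}x^{\mathrm{tree}(F)-1}t^{\mathrm{bdeg}(F)}.$$ 3. Equivalently, $$Q_n(x,y,1,t)=\sum_{F\in\mathcal H_n}x^{\mathrm{tree}(F)-1}y^{\mathrm{imp}(F)}t^{\mathrm{bdeg}(F)}.$$ -/

import Mathlib

open Relation MvPolynomial

/-! The label set `[m] = {1, …, m}` is represented by the ordered set `Fin m = {0, …, m - 1}`;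
the label `i` is the element `i - 1`. Only the order of the labels matters. -/

/-- A plane (ordered) rooted tree on the labeled vertex set `Fin m`: a root and, for every vertex,
the left-to-right list of its children. -/
structure PlaneTree (m : ℕ) where
  root : Fin m
  children : Fin m → List (Fin m)
  nodup : ∀ v, (children v).Nodup
  root_notMem : ∀ v, root ∉ children v
  parent_unique : ∀ u u' v, v ∈ children u → v ∈ children u' → u = u'
  reachable : ∀ v, ReflTransGen (fun u w => w ∈ children u) root v

namespace PlaneTree

variable {m : ℕ} (T : PlaneTree m)

/-- `j` is a descendant of `i`; each vertex is a descendant of itself. -/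
def Desc (i j : Fin m) : Prop := ReflTransGen (fun u w => w ∈ T.children u) i j

/-- The smallest descendant of `i` (as a natural number). -/
noncomputable def beta (i : Fin m) : ℕ := sInf {a : ℕ | ∃ j : Fin m, T.Desc i j ∧ (j : ℕ) = a}

/-- `j` is elder: it has a brother `k` to its right with `beta k < beta j`. Since the children are
listed without repetition, `[j, k]` is a sublist of them exactly if `k` is to the right of `j`. -/
def Elder (j : Fin m) : Prop :=
  ∃ i k : Fin m, [j, k].Sublist (T.children i) ∧ T.beta k < T.beta j

/-- The number of children of `v`. -/
def deg (v : Fin m) : ℕ := (T.children v).length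

/-- The number of elder children of `v`. -/
noncomputable def eldAt (v : Fin m) : ℕ := {j : Fin m | j ∈ T.children v ∧ T.Elder j}.ncard

/-- The number of younger (that is, not elder) children of `v`. -/
noncomputable def young (v : Fin m) : ℕ := T.deg v - T.eldAt v

/-- The number of elder vertices. -/
noncomputable def eld : ℕ := {j : Fin m | T.Elder j}.ncard

/-- `(i, j)` is an improper edge: it is an edge, and neither is `j` elder nor `i < beta j`. -/
def Improper (i j : Fin m) : Prop :=
  j ∈ T.children i ∧ ¬ (T.Elder j ∨ (i : ℕ) < T.beta j)

/-- The number of improper edges. -/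
noncomputable def imp : ℕ := {e : Fin m × Fin m | T.Improper e.1 e.2}.ncard

end PlaneTree

/-- A forest of half-mobile trees with white (labeled) vertex set `Fin n`, in which the black
(unlabeled) vertices have been given provisional names in `Fin numBlack`. White vertices are
`Sum.inl w`, black vertices are `Sum.inr x`. As a rooted forest it is given by the parent
function, which is `none` exactly at the roots of the trees. The conditions are local, so they say
that every connected component is a half-mobile tree on its set of white vertices. The children of
a white vertex carry no order. -/
structure NamedHalfMobileForest (n : ℕ) where
  numBlack : ℕ
  parent : Fin n ⊕ Fin numBlack → Option (Fin n ⊕ Fin numBlack)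
  acyclic : ∀ v, ¬ TransGen (fun u w => parent w = some u) v v
  /-- All children of a black vertex are white. -/
  black_children_white : ∀ x y : Fin numBlack, parent (Sum.inr y) ≠ some (Sum.inr x)
  /-- A black vertex has at least two children. -/
  two_le_children : ∀ x : Fin numBlack, 2 ≤ {w | parent w = some (Sum.inr x)}.ncard
  /-- The cyclically ordered children of a black vertex. -/
  cyc : Fin numBlack → Cycle (Fin n)
  cyc_nodup : ∀ x, (cyc x).Nodup
  mem_cyc : ∀ x w, w ∈ cyc x ↔ parent (Sum.inl w) = some (Sum.inr x)

namespace NamedHalfMobileForest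

variable {n : ℕ} (F : NamedHalfMobileForest n)

/-- White and black vertices. -/
abbrev Vertex : Type := Fin n ⊕ Fin F.numBlack

/-- `w` is a child of `u`. -/
def IsChild (u w : F.Vertex) : Prop := F.parent w = some u

/-- `w` is a descendant of `u`; each vertex is a descendant of itself. -/
def Desc (u w : F.Vertex) : Prop := ReflTransGen F.IsChild u w

/-- The smallest white descendant of `u` (as a natural number). -/
noncomputable def beta (u : F.Vertex) : ℕ :=
  sInf {a : ℕ | ∃ j : Fin n, F.Desc u (Sum.inl j) ∧ (j : ℕ) = a}

/-- The child `w` of the black vertex `x` is the rightmost one: the cyclically ordered children of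
`x` are always drawn such that the child with the smallest `beta` comes last. -/
def IsRightmost (x : Fin F.numBlack) (w : F.Vertex) : Prop :=
  F.IsChild (Sum.inr x) w ∧ ∀ w', F.IsChild (Sum.inr x) w' → F.beta w ≤ F.beta w'

/-- `(u, w)` is an improper edge: either it joins a white vertex `u` to a white child `w` with
`u > beta w`, or `u` is black, `w` is its rightmost child and `u` has a (white) father greater than
`beta w`. -/
def Improper (u w : F.Vertex) : Prop :=
  (∃ i j : Fin n, u = Sum.inl i ∧ w = Sum.inl j ∧ F.IsChild u w ∧ F.beta w < (i : ℕ)) ∨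
  (∃ (x : Fin F.numBlack) (i : Fin n), u = Sum.inr x ∧ F.IsRightmost x w ∧
    F.IsChild (Sum.inl i) u ∧ F.beta w < (i : ℕ))

/-- The number of improper edges. -/
noncomputable def imp : ℕ := {e : F.Vertex × F.Vertex | F.Improper e.1 e.2}.ncard

/-- The number of trees, that is, of roots. -/
noncomputable def tree : ℕ := {v : F.Vertex | F.parent v = none}.ncard

/-- The number of children of `u`. -/
noncomputable def deg (u : F.Vertex) : ℕ := {w : F.Vertex | F.IsChild u w}.ncard

/-- The black degree: the sum of `deg x - 1` over the black vertices `x`. -/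
noncomputable def bdeg : ℕ := ∑ x : Fin F.numBlack, (F.deg (Sum.inr x) - 1)

/-- The map on vertices that fixes the white vertices and renames the black ones by `e`. -/
abbrev relabel {F G : NamedHalfMobileForest n} (e : Fin F.numBlack ≃ Fin G.numBlack) :
    F.Vertex ≃ G.Vertex := Equiv.sumCongr (Equiv.refl (Fin n)) e

/-- `e` is an isomorphism: it respects parents and the cyclic orders. -/
def IsIso (F G : NamedHalfMobileForest n) (e : Fin F.numBlack ≃ Fin G.numBlack) : Prop :=
  (∀ v, G.parent (relabel e v) = (F.parent v).map (relabel e)) ∧ ∀ x, G.cyc (e x) = F.cyc x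

theorem IsIso.symm {F G : NamedHalfMobileForest n} {e : Fin F.numBlack ≃ Fin G.numBlack}
    (h : IsIso F G e) : IsIso G F e.symm := by
  have hs : (relabel e.symm : G.Vertex ≃ F.Vertex) = (relabel e).symm := rfl
  refine ⟨fun v => ?_, fun x => ?_⟩
  · have h1 := h.1 ((relabel e).symm v)
    rw [Equiv.apply_symm_apply] at h1
    rw [hs, h1, Option.map_map, Equiv.symm_comp_self, Option.map_id, id]
  · have h1 := h.2 (e.symm x)
    rw [Equiv.apply_symm_apply] at h1
    exact h1.symm

/-- Two named forests are the same forest if they differ only in the names of the black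
vertices. -/
instance setoid (n : ℕ) : Setoid (NamedHalfMobileForest n) where
  r F G := ∃ e : Fin F.numBlack ≃ Fin G.numBlack, IsIso F G e
  iseqv :=
    { refl := fun F => ⟨Equiv.refl _, fun v => by simp [relabel], fun x => rfl⟩
      symm := fun ⟨e, h⟩ => ⟨e.symm, h.symm⟩
      trans := by
        rintro F G H ⟨e, h⟩ ⟨e', h'⟩
        refine ⟨e.trans e', fun v => ?_, fun x => ?_⟩
        · have h1 := h'.1 (relabel e v)
          rw [h.1 v, Option.map_map] at h1
          have hc : (relabel (F := F) (G := H) (e.trans e') : F.Vertex → H.Vertex)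
              = relabel e' ∘ relabel e := by
            funext w
            rcases w with w | w <;> rfl
          rw [hc]
          exact h1
        · exact (h'.2 (e x)).trans (h.2 x) }

section Invariance

variable {F G : NamedHalfMobileForest n} {e : Fin F.numBlack ≃ Fin G.numBlack}

theorem IsIso.isChild (h : IsIso F G e) (u v : F.Vertex) :
    G.IsChild (relabel e u) (relabel e v) ↔ F.IsChild u v := by
  unfold IsChild
  rw [h.1 v, ← Option.map_some]
  exact (Option.map_injective (relabel e).injective).eq_iff

theorem IsIso.desc (h : IsIso F G e) (u v : F.Vertex) :
    G.Desc (relabel e u) (relabel e v) ↔ F.Desc u v := by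
  constructor
  · intro hd
    have := ReflTransGen.lift (r := G.IsChild) (p := F.IsChild) (relabel e).symm
      (fun a b hab => by
        change F.IsChild _ _
        rw [← h.isChild, Equiv.apply_symm_apply, Equiv.apply_symm_apply]; exact hab) _ _ hd
    simp only [Function.onFun, Equiv.symm_apply_apply] at this
    exact this
  · intro hd
    exact ReflTransGen.lift (p := G.IsChild) (relabel e) (fun a b hab => (h.isChild a b).2 hab) _ _ hd

theorem IsIso.beta (h : IsIso F G e) (u : F.Vertex) : G.beta (relabel e u) = F.beta u := by
  unfold NamedHalfMobileForest.beta
  congr 1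
  ext a
  exact exists_congr fun j => and_congr_left fun _ => h.desc u (Sum.inl j)

theorem IsIso.isRightmost (h : IsIso F G e) (x : Fin F.numBlack) (w : F.Vertex) :
    G.IsRightmost (e x) (relabel e w) ↔ F.IsRightmost x w := by
  unfold IsRightmost
  have hc : ∀ w, G.IsChild (Sum.inr (e x)) (relabel e w) ↔ F.IsChild (Sum.inr x) w :=
    fun w => h.isChild (Sum.inr x) w
  rw [hc, ← (relabel e).forall_congr_right]
  simp only [hc, h.beta]

theorem IsIso.improper (h : IsIso F G e) (u w : F.Vertex) :
    G.Improper (relabel e u) (relabel e w) ↔ F.Improper u w := by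
  unfold Improper
  refine or_congr ?_ ?_
  · refine exists_congr fun i => exists_congr fun j => ?_
    rw [h.isChild, h.beta]
    refine and_congr ?_ (and_congr_left fun _ => ?_)
    · exact (relabel e).apply_eq_iff_eq (y := Sum.inl i)
    · exact (relabel e).apply_eq_iff_eq (y := Sum.inl j)
  · rw [← e.exists_congr_right]
    refine exists_congr fun x => exists_congr fun i => ?_
    rw [h.isRightmost, h.beta]
    refine and_congr ?_ (and_congr_right fun _ => and_congr_left fun _ => ?_)
    · exact (relabel e).apply_eq_iff_eq (y := Sum.inr x)
    · exact h.isChild (Sum.inl i) u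

theorem IsIso.imp_eq (h : IsIso F G e) : F.imp = G.imp := by
  unfold imp
  refine Set.ncard_congr (fun a _ => (relabel e a.1, relabel e a.2)) ?_ ?_ ?_
  · intro a ha
    exact (h.improper a.1 a.2).2 ha
  · intro a b _ _ hab
    simp only [Prod.mk.injEq, EmbeddingLike.apply_eq_iff_eq] at hab
    exact Prod.ext hab.1 hab.2
  · intro b hb
    refine ⟨((relabel e).symm b.1, (relabel e).symm b.2), ?_, ?_⟩
    · change F.Improper _ _
      rw [← h.improper, Equiv.apply_symm_apply, Equiv.apply_symm_apply]
      exact hb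
    · simp only [Equiv.apply_symm_apply]

theorem IsIso.tree_eq (h : IsIso F G e) : F.tree = G.tree := by
  unfold tree
  refine Set.ncard_congr (fun a _ => relabel e a) ?_ (fun a b _ _ hab => (relabel e).injective hab) ?_
  · intro a ha
    change G.parent (relabel e a) = none
    rw [h.1 a, show F.parent a = none from ha]
    rfl
  · intro b hb
    refine ⟨(relabel e).symm b, ?_, Equiv.apply_symm_apply _ _⟩
    have h1 := h.1 ((relabel e).symm b)
    rw [Equiv.apply_symm_apply, show G.parent b = none from hb] at h1
    exact Option.map_eq_none_iff.1 h1.symm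

theorem IsIso.deg_eq (h : IsIso F G e) (u : F.Vertex) : F.deg u = G.deg (relabel e u) := by
  unfold deg
  refine Set.ncard_congr (fun a _ => relabel e a) (fun a ha => (h.isChild u a).2 ha)
    (fun a b _ _ hab => (relabel e).injective hab) ?_
  intro b hb
  refine ⟨(relabel e).symm b, ?_, Equiv.apply_symm_apply _ _⟩
  change F.IsChild _ _
  rw [← h.isChild, Equiv.apply_symm_apply]
  exact hb

theorem IsIso.bdeg_eq (h : IsIso F G e) : F.bdeg = G.bdeg := by
  unfold bdeg
  refine Fintype.sum_equiv e _ _ fun x => ?_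
  rw [h.deg_eq]
  rfl

end Invariance

theorem numBlack_le (F : NamedHalfMobileForest n) : F.numBlack ≤ n := by
  have hex : ∀ x : Fin F.numBlack, ∃ w : Fin n, F.parent (Sum.inl w) = some (Sum.inr x) := by
    intro x
    have h2 := F.two_le_children x
    obtain ⟨w, hw⟩ := Set.nonempty_of_ncard_ne_zero (s := {w | F.parent w = some (Sum.inr x)})
      (by omega)
    rcases w with w | y
    · exact ⟨w, hw⟩
    · exact absurd hw (F.black_children_white x y)
  choose f hf using hex
  have hinj : Function.Injective f := by
    intro x y hxy
    have h1 := hf x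
    rw [hxy, hf y] at h1
    simpa using h1.symm
  simpa using Fintype.card_le_of_injective f hinj

instance finite (n : ℕ) : Finite (NamedHalfMobileForest n) := by
  let C := Σ b : Fin (n + 1), (Fin n ⊕ Fin b → Option (Fin n ⊕ Fin b)) ×
    (Fin b → {s : Cycle (Fin n) // s.Nodup})
  let f : NamedHalfMobileForest n → C := fun F =>
    ⟨⟨F.numBlack, Nat.lt_succ_of_le F.numBlack_le⟩, F.parent, fun x => ⟨F.cyc x, F.cyc_nodup x⟩⟩
  refine Finite.of_injective f ?_
  rintro ⟨b, p, _, _, _, c, hc, _⟩ ⟨b', p', _, _, _, c', hc', _⟩ h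
  have hb : b = b' := by
    have := congrArg (fun s : C => (s.1 : ℕ)) h
    exact this
  subst hb
  have h2 := eq_of_heq (Sigma.mk.inj_iff.1 h).2
  obtain ⟨hp, hcc⟩ := Prod.mk.injEq .. ▸ h2
  have hp' : p = p' := hp
  have hc'' : c = c' := by
    funext x
    exact congrArg Subtype.val (congrFun hcc x)
  subst hp' hc''
  rfl

end NamedHalfMobileForest

/-- The set of forests of half-mobile trees on `[n]`: the black vertices carry no labels, so the
forests are taken up to renaming the black vertices. -/
def HalfMobileForest (n : ℕ) : Type := Quotient (NamedHalfMobileForest.setoid n)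

namespace HalfMobileForest

variable {n : ℕ}

noncomputable instance fintype (n : ℕ) : Fintype (HalfMobileForest n) :=
  haveI : Finite (HalfMobileForest n) :=
    inferInstanceAs (Finite (Quotient (NamedHalfMobileForest.setoid n)))
  Fintype.ofFinite _

/-- The number of half-mobile trees of a forest. -/
noncomputable def tree (F : HalfMobileForest n) : ℕ :=
  Quotient.lift (s := NamedHalfMobileForest.setoid n) NamedHalfMobileForest.tree
    (fun _ _ h => h.elim fun _ h' => h'.tree_eq) F

/-- The number of improper edges of a forest. -/
noncomputable def imp (F : HalfMobileForest n) : ℕ :=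
  Quotient.lift (s := NamedHalfMobileForest.setoid n) NamedHalfMobileForest.imp
    (fun _ _ h => h.elim fun _ h' => h'.imp_eq) F

/-- The black degree of a forest. -/
noncomputable def bdeg (F : HalfMobileForest n) : ℕ :=
  Quotient.lift (s := NamedHalfMobileForest.setoid n) NamedHalfMobileForest.bdeg
    (fun _ _ h => h.elim fun _ h' => h'.bdeg_eq) F

end HalfMobileForest

/-- The polynomials `Q_n(x, y, z, t)`, `n ≥ 1`, with `x = X 0`, `y = X 1`, `z = X 2`, `t = X 3`:
`Q_1 = 1` and `Q_{n+1} = [x + n z + (y + t) (n + y ∂_y)] Q_n`. The value at `n = 0` is a dummy. -/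
noncomputable def chapotonQ : ℕ → MvPolynomial (Fin 4) ℤ
  | 0 => 0
  | 1 => 1
  | n + 2 =>
    (X 0 + ((n + 1 : ℕ) : MvPolynomial (Fin 4) ℤ) * X 2) * chapotonQ (n + 1)
      + (X 1 + X 3) * (((n + 1 : ℕ) : MvPolynomial (Fin 4) ℤ) * chapotonQ (n + 1)
          + X 1 * pderiv 1 (chapotonQ (n + 1)))

/-- `Q_n(x, y, 1, t)` in `ℤ[x, y, t]`, with `x = X 0`, `y = X 1`, `t = X 2`. -/
noncomputable def chapotonQOne (n : ℕ) : MvPolynomial (Fin 3) ℤ :=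
  aeval ![X 0, X 1, 1, X 2] (chapotonQ n)

/-- `Q_{n,k}(x, t)` in `ℤ[x, t]`, with `x = X 0`, `t = X 1`: the coefficient of `y ^ k` in
`Q_n(x, y, 1, t)`, regarded as a polynomial in `y` over `ℤ[x, t]`. -/
noncomputable def chapotonQCoeff (n k : ℕ) : MvPolynomial (Fin 2) ℤ :=
  (aeval (![Polynomial.C (X 0), Polynomial.X, 1, Polynomial.C (X 1)] :
      Fin 4 → Polynomial (MvPolynomial (Fin 2) ℤ)) (chapotonQ n)).coeff k

/-! Removing the root, which carries the smallest label, turns a plane tree on `[n+1]` into an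
ordered forest on `n` labels whose trees are ordered as well. No edge at the removed root is
improper, so the three statistics count vertices of the forest: young roots, elder vertices, and
young vertices with a descendant smaller than their father.

Bijection. Siblings have different β, and the young members of a sibling list are its right-to-left
minima with respect to β. Cut the list behind each of them. Every block ends with its minimum, and
these minima increase from left to right. Hence a block can be recovered from its cyclic order, and
the list from the set of its cyclically ordered blocks. A block of size at least two becomes the set
of children of a new black vertex; a singleton stays a white vertex without black father. Descent
among white vertices, and with it β, is unchanged. A block of size `d` contains `d - 1` elder
vertices and one young vertex, the rightmost child. The work is done by `IsBlocks.eq_of_cycles_eq`,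
`exists_matches_of_named`, `exists_named_of_ordered`, `Matches.eq` and `Matches.equiv`.

Generating function. Give an elder vertex the weight `t`, a young root `x`, a young vertex below an
improper edge `y`, every other vertex 1. A new largest label `N` enters a forest on `n` labels in
one of four ways. At the right end of the list of roots it contributes `x`, at the right end of the
children of a vertex 1. As a leaf directly left of a vertex it contributes `t`. As new father of a
vertex `c`, in the place of `c`, it contributes `y`. For an improper edge `(c, j)`, `N` takes the
place of `c`, keeps the children up to `j`, and receives `c` with the remaining children directly
right of `j` (factor `y`) or left of `j` (factor `t`). The total factor is `x + n + (y + t)(n +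
imp)`, and `imp` acts on the weight as `y ∂_y`: this is the recursion of `Q_n`
(`sum_weight_insertions`, `pderiv_weight`). Since `N` can be deleted again, each forest arises
exactly once. The forests therefore sum to `x Q_n`, and `x` cancels because every forest has a young
root. -/

/-! ### Plane forests and the insertion of a new largest label -/

/-- Plane forests with natural number labels: the first vertex `a`, the forest `k` of its
descendants, and the forest `r` to its right. -/
inductive LabeledForest : Type
  | nil : LabeledForest
  | cons (a : ℕ) (k r : LabeledForest) : LabeledForest

namespace LabeledForest

/-- The multiset of labels. -/
def labels : LabeledForest → Multiset ℕ
  | nil => 0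
  | cons a k r => a ::ₘ (k.labels + r.labels)

/-- The smallest label. -/
def minLabel : LabeledForest → WithTop ℕ
  | nil => ⊤
  | cons a k r => min (min (a : WithTop ℕ) k.minLabel) r.minLabel

/-- The weight of a vertex whose father is `p` (`none` for a root), whose smallest descendant is
`b`, and for which `m` is the smallest label to the right below the same father. -/
noncomputable def vertexWeight (p : Option ℕ) (b m : WithTop ℕ) : MvPolynomial (Fin 3) ℤ :=
  if m ≤ b then X 2 else
    match p with
    | none => X 0
    | some i => if b < (i : WithTop ℕ) then X 1 else 1

/-- The weight of a forest below `p`. -/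
noncomputable def weight : Option ℕ → LabeledForest → MvPolynomial (Fin 3) ℤ
  | _, nil => 1
  | p, cons a k r =>
    vertexWeight p (min (a : WithTop ℕ) k.minLabel) r.minLabel * weight (some a) k * weight p r

/-- The number of improper roots, seen as children of `c`. -/
def topImproper (c : ℕ) : LabeledForest → ℕ
  | nil => 0
  | cons a k r =>
    (if ¬ r.minLabel ≤ min (a : WithTop ℕ) k.minLabel ∧
      min (a : WithTop ℕ) k.minLabel < (c : WithTop ℕ) then 1 else 0) + topImproper c r

/-- The number of improper edges inside a forest. -/
def innerImproper : LabeledForest → ℕ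
  | nil => 0
  | cons a k r => topImproper a k + innerImproper k + innerImproper r

/-- The number of vertices. -/
def size : LabeledForest → ℕ
  | nil => 0
  | cons _ k r => 1 + size k + size r

/-- The forests with at least two trees that arise from the forest of children of `c` by cutting
it behind an improper child `j`, hanging the right part below `c`, and putting `c` next to `j`. -/
def splits (c : ℕ) : LabeledForest → List LabeledForest
  | nil => []
  | cons j k r =>
    (if ¬ r.minLabel ≤ min (j : WithTop ℕ) k.minLabel ∧
      min (j : WithTop ℕ) k.minLabel < (c : WithTop ℕ) then
        [cons j k (cons c r nil), cons c r (cons j k nil)] else []) ++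
    (splits c r).map (cons j k)

/-- All forests that arise by inserting the new largest label `N`. -/
def insertions (N : ℕ) : LabeledForest → List LabeledForest
  | nil => [cons N nil nil]
  | cons c k r =>
    (cons N nil (cons c k r) :: cons N (cons c k nil) r ::
      (splits c k).map (fun K => cons N K r)) ++
    ((insertions N k).map (fun k' => cons c k' r) ++ (insertions N r).map (fun r' => cons c k r'))

/-- Undo `splits`. -/
def unsplit : LabeledForest → ℕ × LabeledForest
  -- Dummy value: `mergeAt` treats a vertex without children separately.
  | nil => (0, nil)
  | cons a k nil => (a, k)
  | cons a k (cons b l nil) =>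
    if min (b : WithTop ℕ) l.minLabel ≤ min (a : WithTop ℕ) k.minLabel then (a, cons b l k)
    else (b, cons a k l)
  | cons a k (cons b l (cons d m r)) =>
    ((unsplit (cons b l (cons d m r))).1, cons a k (unsplit (cons b l (cons d m r))).2)

/-- Delete the vertex `N`, given its forest of children and the forest to its right. -/
def mergeAt : LabeledForest → LabeledForest → LabeledForest
  | nil, r => r
  | cons a k l, r => cons (unsplit (cons a k l)).1 (unsplit (cons a k l)).2 r

/-- Undo `insertions`. -/
def delete (N : ℕ) : LabeledForest → LabeledForest
  | nil => nil
  | cons a k r =>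
    if a = N then mergeAt k r
    else if N ∈ k.labels then cons a (delete N k) r else cons a k (delete N r)

theorem minLabel_mem (F : LabeledForest) (m : ℕ) (h : F.minLabel = m) : m ∈ F.labels := by
  induction F with
  | nil => simp [minLabel] at h
  | cons a k r hk hr =>
    simp only [minLabel] at h
    simp only [labels, Multiset.mem_cons, Multiset.mem_add]
    rcases min_choice (min (a : WithTop ℕ) k.minLabel) r.minLabel with h1 | h1
    · rw [h1] at h
      rcases min_choice (a : WithTop ℕ) k.minLabel with h2 | h2
      · rw [h2] at h
        left; exact_mod_cast h.symm
      · exact Or.inr (Or.inl (hk (h2 ▸ h)))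
    · exact Or.inr (Or.inr (hr (h1 ▸ h)))

theorem minLabel_le (F : LabeledForest) (m : ℕ) (h : m ∈ F.labels) : F.minLabel ≤ m := by
  induction F with
  | nil => simp [labels] at h
  | cons a k r hk hr =>
    simp only [labels, Multiset.mem_cons, Multiset.mem_add] at h
    simp only [minLabel]
    rcases h with rfl | h | h
    · exact (min_le_left _ _).trans (min_le_left _ _)
    · exact (min_le_left _ _).trans ((min_le_right _ _).trans (hk h))
    · exact (min_le_right _ _).trans (hr h)

/-- The cut lies behind a child with a descendant below `c`, so adding `c` does not change the
minimum. Hence `N`, put in the place of `c`, inherits the weight of `c`. -/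
theorem minLabel_of_mem_splits {c : ℕ} {k K : LabeledForest} (h : K ∈ splits c k) :
    K.minLabel = k.minLabel ∧ k.minLabel < c := by
  induction k generalizing K with
  | nil => simp [splits] at h
  | cons j k r _ hr =>
    simp only [splits, List.mem_append, List.mem_map] at h
    rcases h with h | ⟨K', hK', rfl⟩
    · split_ifs at h with hc
      · obtain ⟨h1, h2⟩ := hc
        simp only [List.mem_cons, List.not_mem_nil, or_false] at h
        have h3 : min (min (j : WithTop ℕ) k.minLabel) (min (c : WithTop ℕ) r.minLabel)
            = min (j : WithTop ℕ) k.minLabel :=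
          min_eq_left (le_min h2.le (not_le.1 h1).le)
        have h4 : min (min (j : WithTop ℕ) k.minLabel) r.minLabel
            = min (j : WithTop ℕ) k.minLabel := min_eq_left (not_le.1 h1).le
        rcases h with rfl | rfl
        · simp only [minLabel, min_top_right]
          rw [h3, h4]; exact ⟨rfl, h2⟩
        · simp only [minLabel, min_top_right]
          rw [min_comm, h3, h4]; exact ⟨rfl, h2⟩
      · simp at h
    · obtain ⟨h1, h2⟩ := hr hK'
      simp only [minLabel]
      rw [h1]
      exact ⟨rfl, (min_le_right _ _).trans_lt h2⟩

theorem labels_of_mem_splits {c : ℕ} {k K : LabeledForest} (h : K ∈ splits c k) :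
    K.labels = c ::ₘ k.labels := by
  induction k generalizing K with
  | nil => simp [splits] at h
  | cons j k r _ hr =>
    simp only [splits, List.mem_append, List.mem_map] at h
    rcases h with h | ⟨K', hK', rfl⟩
    · split_ifs at h with hc
      · simp only [List.mem_cons, List.not_mem_nil, or_false] at h
        rcases h with rfl | rfl
        · simp only [labels, ← Multiset.singleton_add]; abel
        · simp only [labels, ← Multiset.singleton_add]; abel
      · simp at h
    · rw [labels, hr hK']
      simp only [labels, ← Multiset.singleton_add]; abel

theorem labels_of_mem_insertions {N : ℕ} {T F : LabeledForest} (h : F ∈ insertions N T) :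
    F.labels = N ::ₘ T.labels := by
  induction T generalizing F with
  | nil => simp only [insertions, List.mem_singleton] at h; subst h; rfl
  | cons c k r hk hr =>
    simp only [insertions, List.mem_append, List.mem_cons, List.mem_map] at h
    rcases h with (rfl | rfl | ⟨K, hK, rfl⟩) | ⟨F', hF, rfl⟩ | ⟨F', hF, rfl⟩
    · simp only [labels, ← Multiset.singleton_add]; abel
    · simp only [labels, ← Multiset.singleton_add]; abel
    · rw [labels, labels_of_mem_splits hK]
      simp only [labels, ← Multiset.singleton_add]; abel
    · rw [labels, hk hF]
      simp only [labels, ← Multiset.singleton_add]; abel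
    · rw [labels, hr hF]
      simp only [labels, ← Multiset.singleton_add]; abel

theorem minLabel_of_mem_insertions {N : ℕ} {T F : LabeledForest} (h : F ∈ insertions N T) :
    F.minLabel = min (N : WithTop ℕ) T.minLabel := by
  induction T generalizing F with
  | nil => simp only [insertions, List.mem_singleton] at h; subst h; simp [minLabel]
  | cons c k r hk hr =>
    simp only [insertions, List.mem_append, List.mem_cons, List.mem_map] at h
    rcases h with (rfl | rfl | ⟨K, hK, rfl⟩) | ⟨F', hF, rfl⟩ | ⟨F', hF, rfl⟩
    · simp [minLabel]
    · simp [minLabel, min_assoc]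
    · obtain ⟨h1, h2⟩ := minLabel_of_mem_splits hK
      simp only [minLabel]
      rw [h1, min_eq_right h2.le, min_assoc]
    · simp only [minLabel]; rw [hk hF]; ac_rfl
    · simp only [minLabel]; rw [hr hF]; ac_rfl

/-- Cut behind an improper child: the total weight. -/
theorem sum_weight_splits (N c : ℕ) (hc : c < N) (k : LabeledForest) :
    ((splits c k).map (weight (some N))).sum
      = (X 1 + X 2) * (topImproper c k : MvPolynomial (Fin 3) ℤ) * weight (some c) k := by
  induction k with
  | nil => simp [splits, topImproper]
  | cons j k r _ hr =>
    have hcN : (c : WithTop ℕ) < (N : WithTop ℕ) := by exact_mod_cast hc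
    have hmap : (((splits c r).map (cons j k)).map (weight (some N))).sum
        = vertexWeight (some c) (min (j : WithTop ℕ) k.minLabel) r.minLabel *
          weight (some j) k * ((splits c r).map (weight (some N))).sum := by
      rw [List.map_map, ← List.sum_map_mul_left]
      congr 1
      refine List.map_congr_left fun K hK => ?_
      obtain ⟨h1, h2⟩ := minLabel_of_mem_splits hK
      simp only [Function.comp, weight, h1]
      congr 2
      unfold vertexWeight
      by_cases h3 : r.minLabel ≤ min (j : WithTop ℕ) k.minLabel
      · simp [h3]
      -- A cut inside `r` forces `r.minLabel < c`. A young `j` to the left of `r` has a still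
      -- smaller descendant, so it is improper below `c` as well as below `N`.
      · have h4 := (not_le.1 h3).trans h2
        simp only [h3, if_false, h4, h4.trans hcN, if_true]
    simp only [splits, topImproper, List.map_append, List.sum_append, hmap, hr]
    by_cases hj : ¬ r.minLabel ≤ min (j : WithTop ℕ) k.minLabel ∧
      min (j : WithTop ℕ) k.minLabel < (c : WithTop ℕ)
    · obtain ⟨h1, h2⟩ := hj
      have h3 : ¬ min (c : WithTop ℕ) r.minLabel ≤ min (j : WithTop ℕ) k.minLabel :=
        not_le.2 (lt_min h2 (not_le.1 h1))
      have htop : ∀ (a : ℕ) (m : WithTop ℕ), ¬ (⊤ : WithTop ℕ) ≤ min (a : WithTop ℕ) m :=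
        fun a m h => absurd (h.trans (min_le_left _ _)) (by simp)
      have h5 : min (c : WithTop ℕ) r.minLabel < N := (min_le_left _ _).trans_lt hcN
      -- With `j` before `c` both are improper below `N`; with `c` before `j` the vertex `c` is
      -- elder and `j` improper. The old weight of `j` accounts for one factor `X 1`, which leaves
      -- `X 1 + X 2`.
      rw [if_pos ⟨h1, h2⟩, if_pos ⟨h1, h2⟩]
      simp only [List.map_cons, List.map_nil, List.sum_cons, List.sum_nil, weight, minLabel,
        min_top_right, vertexWeight, h1, h2, h3, h5, h2.trans hcN, htop, (not_le.1 h3).le, if_true,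
        if_false]
      push_cast
      ring
    · rw [if_neg hj, if_neg hj]
      simp only [List.map_nil, List.sum_nil, weight]
      push_cast
      ring

/-- Away from the place of insertion all weights persist, since a new maximum makes nobody else
elder or improper. The first two terms count the right ends of sibling lists: one below `p`, and one
below each vertex. The hypothesis on `p` keeps a leaf `N` at such an end from being improper. Each
vertex `c` adds `X 2` for a leaf on its left and `X 1` for `N` as its father, and
`sum_weight_splits` adds `X 1 + X 2` for each improper child of `c`. -/
theorem sum_weight_insertions (N : ℕ) (p : Option ℕ) (hp : ∀ i, p = some i → i < N)
    (T : LabeledForest) (hT : ∀ a ∈ T.labels, a < N) :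
    ((insertions N T).map (weight p)).sum
      = ((p.elim (X 0) fun _ => 1) + (T.size : MvPolynomial (Fin 3) ℤ)
          + (X 1 + X 2) * ((T.size : MvPolynomial (Fin 3) ℤ) + (T.innerImproper : MvPolynomial (Fin 3) ℤ)))
        * weight p T := by
  induction T generalizing p with
  | nil =>
    have h0 : ¬ (⊤ : WithTop ℕ) ≤ (N : WithTop ℕ) := by simp
    cases p with
    | none => simp [insertions, size, innerImproper, weight, vertexWeight, minLabel]
    | some i =>
      have := hp i rfl
      have h1 : ¬ (N : WithTop ℕ) < (i : WithTop ℕ) := by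
        rw [not_lt]; exact_mod_cast this.le
      simp only [insertions, size, innerImproper, weight, vertexWeight, minLabel, min_top_right,
        List.map_cons, List.map_nil, List.sum_cons, List.sum_nil, h0, h1, if_false]
      simp
  | cons c k r hk hr =>
    have hc : c < N := hT c (by simp [labels])
    have hcN : (c : WithTop ℕ) < (N : WithTop ℕ) := by exact_mod_cast hc
    have hb : min (c : WithTop ℕ) k.minLabel < N := (min_le_left _ _).trans_lt hcN
    have htop : ∀ (a : ℕ) (m : WithTop ℕ), ¬ (⊤ : WithTop ℕ) ≤ min (a : WithTop ℕ) m :=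
      fun a m h => absurd (h.trans (min_le_left _ _)) (by simp)
    have e1 : weight p (cons N nil (cons c k r)) = X 2 * weight p (cons c k r) := by
      have h1 : min (min (c : WithTop ℕ) k.minLabel) r.minLabel ≤ N :=
        (min_le_left _ _).trans hb.le
      rw [weight]
      simp only [vertexWeight, minLabel, min_top_right, h1, if_true, weight]
      ring
    have e2 : weight p (cons N (cons c k nil) r) = X 1 * weight p (cons c k r) := by
      simp only [weight, minLabel, min_top_right, min_eq_right hb.le]
      have : vertexWeight (some N) (min (c : WithTop ℕ) k.minLabel) ⊤ = X 1 := by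
        simp only [vertexWeight, htop, hb, if_true, if_false]
      rw [this]; ring
    have e3 : ((splits c k).map (weight p ∘ fun K => cons N K r)).sum
        = (X 1 + X 2) * (topImproper c k : MvPolynomial (Fin 3) ℤ) * weight p (cons c k r) := by
      have : ((splits c k).map (weight p ∘ fun K => cons N K r))
          = (splits c k).map fun K =>
            (vertexWeight p (min (c : WithTop ℕ) k.minLabel) r.minLabel * weight p r) *
              weight (some N) K := by
        refine List.map_congr_left fun K hK => ?_
        obtain ⟨h1, h2⟩ := minLabel_of_mem_splits hK
        simp only [Function.comp, weight, h1, min_eq_right h2.le, min_eq_right (h2.trans hcN).le]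
        ring
      rw [this, List.sum_map_mul_left, sum_weight_splits N c hc, weight]
      ring
    have e4 : ((insertions N k).map (weight p ∘ fun k' => cons c k' r)).sum
        = (1 + (k.size : MvPolynomial (Fin 3) ℤ) + (X 1 + X 2) *
          ((k.size : MvPolynomial (Fin 3) ℤ) + (k.innerImproper : MvPolynomial (Fin 3) ℤ))) * weight p (cons c k r) := by
      have : ((insertions N k).map (weight p ∘ fun k' => cons c k' r))
          = (insertions N k).map fun K =>
            (vertexWeight p (min (c : WithTop ℕ) k.minLabel) r.minLabel * weight p r) *
              weight (some c) K := by
        refine List.map_congr_left fun K hK => ?_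
        have h1 := minLabel_of_mem_insertions hK
        simp only [Function.comp, weight, h1]
        rw [← min_assoc, min_eq_left hcN.le]
        ring
      rw [this, List.sum_map_mul_left, hk (some c) (by rintro i ⟨⟩; exact hc)
        (fun a ha => hT a (by simp [labels, ha])), weight]
      simp only [Option.elim]
      ring
    have e5 : ((insertions N r).map (weight p ∘ fun r' => cons c k r')).sum
        = ((p.elim (X 0) fun _ => 1) + (r.size : MvPolynomial (Fin 3) ℤ) + (X 1 + X 2) *
          ((r.size : MvPolynomial (Fin 3) ℤ) + (r.innerImproper : MvPolynomial (Fin 3) ℤ))) * weight p (cons c k r) := by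
      have : ((insertions N r).map (weight p ∘ fun r' => cons c k r'))
          = (insertions N r).map fun K =>
            (vertexWeight p (min (c : WithTop ℕ) k.minLabel) r.minLabel * weight (some c) k) *
              weight p K := by
        refine List.map_congr_left fun K hK => ?_
        have h1 := minLabel_of_mem_insertions hK
        simp only [Function.comp, weight, h1]
        congr 2
        -- A vertex on the left is elder after the insertion only if it was elder before, because
        -- `N` exceeds its smallest descendant.
        have : min (N : WithTop ℕ) r.minLabel ≤ min (c : WithTop ℕ) k.minLabel ↔
            r.minLabel ≤ min (c : WithTop ℕ) k.minLabel := by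
          rw [min_le_iff, or_iff_right (not_le.2 hb)]
        simp only [vertexWeight, this]
      rw [this, List.sum_map_mul_left, hr p hp (fun a ha => hT a (by simp [labels, ha])), weight]
      ring
    simp only [insertions, List.map_append, List.map_cons, List.sum_append, List.sum_cons,
      List.map_map, e1, e2, e3, e4, e5, size, innerImproper]
    push_cast
    ring

/-- A common minimum would be finite because of `b`, hence a label on both sides. -/
theorem not_minLabel_eq {k l : LabeledForest} (b : ℕ) (h : ∀ m ∈ k.labels, m ≠ b ∧ m ∉ l.labels) :
    min (b : WithTop ℕ) l.minLabel ≠ k.minLabel := by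
  intro he
  have h1 : k.minLabel ≠ ⊤ := by
    rw [← he]; exact ne_of_lt ((min_le_left _ _).trans_lt (WithTop.coe_lt_top b))
  obtain ⟨m, hm⟩ := WithTop.ne_top_iff_exists.1 h1
  have h2 := minLabel_mem k m hm.symm
  have h3 : (cons b l nil).minLabel = m := by simp only [minLabel, min_top_right]; exact he.trans hm.symm
  have h4 := minLabel_mem _ m h3
  simp only [labels, Multiset.mem_cons, Multiset.mem_add] at h4
  have := h m h2
  simp_all

/-- Having at least two trees separates these insertions from those in which `N` has no child or one
child. -/
theorem mem_splits_shape {c : ℕ} {k K : LabeledForest} (h : K ∈ splits c k) :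
    ∃ a l b m r, K = cons a l (cons b m r) := by
  cases k with
  | nil => simp [splits] at h
  | cons j k r =>
    simp only [splits, List.mem_append, List.mem_map] at h
    rcases h with h | ⟨K', hK', rfl⟩
    · split_ifs at h with hc
      · simp only [List.mem_cons, List.not_mem_nil, or_false] at h
        rcases h with rfl | rfl <;> exact ⟨_, _, _, _, _, rfl⟩
      · simp at h
    · cases K' with
      | nil =>
        have := labels_of_mem_splits hK'
        simp [labels] at this
      | cons b m r => exact ⟨_, _, _, _, _, rfl⟩

/-- The last two trees are those of `c` and `j` in some order, and that of `j` has the smaller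
minimum, so comparing minima tells them apart. -/
theorem unsplit_of_mem_splits {c : ℕ} {k K : LabeledForest} (h : K ∈ splits c k) :
    unsplit K = (c, k) := by
  induction k generalizing K with
  | nil => simp [splits] at h
  | cons j k r _ hr =>
    simp only [splits, List.mem_append, List.mem_map] at h
    rcases h with h | ⟨K', hK', rfl⟩
    · split_ifs at h with hc
      · obtain ⟨h1, h2⟩ := hc
        simp only [List.mem_cons, List.not_mem_nil, or_false] at h
        have h3 : ¬ min (c : WithTop ℕ) r.minLabel ≤ min (j : WithTop ℕ) k.minLabel :=
          not_le.2 (lt_min h2 (not_le.1 h1))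
        rcases h with rfl | rfl
        · rw [unsplit, if_neg h3]
        · rw [unsplit, if_pos (not_le.1 h3).le]
      · simp at h
    · obtain ⟨a, l, b, m, r', rfl⟩ := mem_splits_shape hK'
      rw [unsplit, hr hK']

/-- Of the last two trees, the one with the smaller minimum plays the part of the improper child.
Distinct labels exclude ties, which makes it young and improper. -/
theorem mem_splits_unsplit (a b : ℕ) (k l r : LabeledForest)
    (h : (cons a k (cons b l r)).labels.Nodup) :
    cons a k (cons b l r) ∈
      splits (unsplit (cons a k (cons b l r))).1 (unsplit (cons a k (cons b l r))).2 := by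
  induction r generalizing a k b l with
  | nil =>
    rw [unsplit]
    simp only [labels, Multiset.nodup_cons, Multiset.nodup_add, Multiset.mem_add,
      Multiset.mem_cons, add_zero, Multiset.disjoint_cons_right] at h
    obtain ⟨h1, h2, ⟨h3, h4⟩, h5, h6⟩ := h
    split_ifs with hc
    · have h7 : ¬ k.minLabel ≤ min (b : WithTop ℕ) l.minLabel := by
        intro hle
        have hle' := hle.antisymm (hc.trans (min_le_right _ _))
        refine not_minLabel_eq b ?_ hle'.symm
        intro m hm
        exact ⟨fun h => h5 (h ▸ hm), fun h => Multiset.disjoint_left.1 h6 hm h⟩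
      have h8 : min (b : WithTop ℕ) l.minLabel < (a : WithTop ℕ) := by
        refine lt_of_le_of_ne (hc.trans (min_le_left _ _)) fun he => ?_
        have h9 : (cons b l nil).minLabel = (a : WithTop ℕ) := by
          simp only [minLabel, min_top_right]; exact he
        have := minLabel_mem _ a h9
        simp only [labels, Multiset.mem_cons, add_zero] at this
        tauto
      simp [splits, h7, h8]
    · have h7 := not_le.1 hc
      have h8 := lt_min_iff.1 h7
      simp only [splits, not_le.2 h8.2, h8.1, not_false_eq_true, true_and, if_true]
      simp
  | cons d m r _ hr =>
    rw [unsplit]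
    simp only [splits, List.mem_append, List.mem_map]
    right
    refine ⟨_, hr b d l m ?_, rfl⟩
    rw [labels, Multiset.nodup_cons, Multiset.nodup_add] at h
    exact h.2.2.1

/-- The number of children of `N` (none, one, or more) reveals which kind of insertion was made. -/
theorem delete_of_mem_insertions {N : ℕ} {T F : LabeledForest} (hT : N ∉ T.labels)
    (h : F ∈ insertions N T) : delete N F = T := by
  induction T generalizing F with
  | nil =>
    simp only [insertions, List.mem_singleton] at h
    subst h
    simp [delete, mergeAt]
  | cons c k r hk hr =>
    simp only [labels, Multiset.mem_cons, Multiset.mem_add, not_or] at hT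
    obtain ⟨h1, h2, h3⟩ := hT
    simp only [insertions, List.mem_append, List.mem_cons, List.mem_map] at h
    rcases h with (rfl | rfl | ⟨K, hK, rfl⟩) | ⟨F', hF, rfl⟩ | ⟨F', hF, rfl⟩
    · simp [delete, mergeAt]
    · simp [delete, mergeAt, unsplit]
    · have h4 := unsplit_of_mem_splits hK
      obtain ⟨a, l, b, m, r', rfl⟩ := mem_splits_shape hK
      simp only [delete, if_true, mergeAt, h4]
    · have h4 : N ∈ F'.labels := by simp [labels_of_mem_insertions hF]
      simp only [delete, Ne.symm h1, if_false, h4, if_true, hk h2 hF]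
    · simp only [delete, Ne.symm h1, if_false, h2, hr h3 hF]

theorem mem_insertions_delete {N : ℕ} {F : LabeledForest} (hF : F.labels.Nodup)
    (hN : N ∈ F.labels) : F ∈ insertions N (delete N F) := by
  induction F with
  | nil => simp [labels] at hN
  | cons a k r hk hr =>
    have hF' := hF
    simp only [labels, Multiset.nodup_cons, Multiset.nodup_add, Multiset.mem_add] at hF'
    obtain ⟨h1, h2, h3, h4⟩ := hF'
    simp only [labels, Multiset.mem_cons, Multiset.mem_add] at hN
    rw [delete]
    split_ifs with ha hNk
    · subst ha
      rcases k with _ | ⟨b, l, s⟩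
      · rw [mergeAt]
        cases r with
        | nil => simp [insertions]
        | cons => simp [insertions]
      · rw [mergeAt]
        rcases s with _ | ⟨d, m, s⟩
        · simp [unsplit, insertions]
        · have := mem_splits_unsplit b d l m s h2
          simp only [insertions, List.mem_append, List.mem_cons, List.mem_map]
          exact Or.inl (Or.inr (Or.inr ⟨_, this, rfl⟩))
    · simp only [insertions, List.mem_append, List.mem_cons, List.mem_map]
      exact Or.inr (Or.inl ⟨_, hk h2 hNk, rfl⟩)
    · have : N ∈ r.labels := by tauto
      simp only [insertions, List.mem_append, List.mem_cons, List.mem_map]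
      exact Or.inr (Or.inr ⟨_, hr h3 this, rfl⟩)

theorem nodup_splits {c : ℕ} {k : LabeledForest} (hc : c ∉ k.labels) : (splits c k).Nodup := by
  induction k with
  | nil => simp [splits]
  | cons j k r _ hr =>
    simp only [labels, Multiset.mem_cons, Multiset.mem_add, not_or] at hc
    obtain ⟨h1, h2, h3⟩ := hc
    rw [splits, List.nodup_append]
    refine ⟨?_, (hr h3).map fun x y h => by simpa using h, ?_⟩
    · split_ifs
      · simp [Ne.symm h1]
      · simp
    · intro x hx y hy hxy
      subst hxy
      rw [List.mem_map] at hy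
      obtain ⟨K, hK, rfl⟩ := hy
      obtain ⟨a, l, b, m, r', rfl⟩ := mem_splits_shape hK
      split_ifs at hx
      · simp [Ne.symm h1] at hx
      · simp at hx

theorem nodup_insertions {N : ℕ} {T : LabeledForest} (hN : N ∉ T.labels) (hT : T.labels.Nodup) :
    (insertions N T).Nodup := by
  induction T with
  | nil => simp [insertions]
  | cons c k r hk hr =>
    simp only [labels, Multiset.mem_cons, Multiset.mem_add, not_or, Multiset.nodup_cons,
      Multiset.nodup_add] at hN hT
    obtain ⟨h1, h2, h3⟩ := hN
    obtain ⟨⟨h4, h4'⟩, h5, h6, h7⟩ := hT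
    rw [insertions, List.nodup_append, List.nodup_append]
    refine ⟨?_, ⟨(hk h2 h5).map fun x y h => by simpa using h,
      (hr h3 h6).map fun x y h => by simpa using h, ?_⟩, ?_⟩
    · simp only [List.nodup_cons, List.mem_cons, List.mem_map, not_or, not_exists, not_and]
      refine ⟨⟨by simp, fun K hK => ?_⟩, fun K hK => ?_, (nodup_splits h4).map fun x y h => by
        simpa using h⟩
      · obtain ⟨a, l, b, m, r', rfl⟩ := mem_splits_shape hK
        simp
      · obtain ⟨a, l, b, m, r', rfl⟩ := mem_splits_shape hK
        simp
    · intro x hx y hy hxy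
      subst hxy
      rw [List.mem_map] at hx hy
      obtain ⟨K, hK, rfl⟩ := hx
      obtain ⟨K', hK', he⟩ := hy
      injection he with _ he _
      subst he
      exact h2 (labels_of_mem_insertions hK ▸ Multiset.mem_cons_self _ _)
    · intro x hx y hy hxy
      subst hxy
      have : ∃ l s, x = cons c l s := by
        simp only [List.mem_append, List.mem_map] at hy
        rcases hy with ⟨_, _, rfl⟩ | ⟨_, _, rfl⟩ <;> exact ⟨_, _, rfl⟩
      obtain ⟨l, s, rfl⟩ := this
      simp only [List.mem_cons, List.mem_map] at hx
      rcases hx with hx | hx | ⟨_, _, hx⟩ <;> injection hx with he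
      · exact h1 he.symm
      · exact h1 he.symm
      · exact h1 he

/-- All plane forests with labels `0, …, n - 1`. -/
def all : ℕ → List LabeledForest
  | 0 => [nil]
  | n + 1 => (all n).flatMap (insertions n)

theorem mem_all (n : ℕ) (F : LabeledForest) : F ∈ all n ↔ F.labels = Multiset.range n := by
  induction n generalizing F with
  | zero =>
    simp only [all, List.mem_singleton, Multiset.range_zero]
    constructor
    · rintro rfl; rfl
    · intro h
      cases F with
      | nil => rfl
      | cons => simp [labels] at h
  | succ n ih =>
    simp only [all, List.mem_flatMap, Multiset.range_succ]
    constructor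
    · rintro ⟨T, hT, hF⟩
      rw [labels_of_mem_insertions hF, (ih T).1 hT]
    · intro h
      have h1 : F ∈ insertions n (delete n F) :=
        mem_insertions_delete (by rw [h, ← Multiset.range_succ]; exact Multiset.nodup_range _)
          (by simp [h])
      refine ⟨_, (ih _).2 ?_, h1⟩
      rw [labels_of_mem_insertions h1] at h
      exact (Multiset.cons_inj_right _).1 h

/-- Insertions into different forests differ, because deleting the largest label recovers the
forest. -/
theorem nodup_all (n : ℕ) : (all n).Nodup := by
  induction n with
  | zero => simp [all]
  | succ n ih =>
    rw [all, List.nodup_flatMap]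
    have hn : ∀ T ∈ all n, n ∉ T.labels := fun T hT => by rw [(mem_all n T).1 hT]; simp
    refine ⟨fun T hT => nodup_insertions (hn T hT) ?_, ?_⟩
    · rw [(mem_all n T).1 hT]; exact Multiset.nodup_range _
    · refine List.Pairwise.imp_of_mem ?_ ih
      intro T T' hT hT' hne F hF hF'
      exact hne ((delete_of_mem_insertions (hn T hT) hF).symm.trans
        (delete_of_mem_insertions (hn T' hT') hF'))

theorem size_eq (T : LabeledForest) : T.size = Multiset.card T.labels := by
  induction T with
  | nil => rfl
  | cons a k r hk hr =>
    simp only [size, labels, Multiset.card_cons, Multiset.card_add, hk, hr]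
    ring

/-- The number of improper roots below `p`. -/
def rootImproper (p : Option ℕ) (T : LabeledForest) : ℕ := p.elim 0 fun c => topImproper c T

/-- Exactly the improper vertices contribute a factor `X 1`, so the weight is an eigenvector of the
Euler operator in `X 1`. -/
theorem pderiv_weight (p : Option ℕ) (T : LabeledForest) :
    X 1 * pderiv 1 (weight p T)
      = ((rootImproper p T + innerImproper T : ℕ) : MvPolynomial (Fin 3) ℤ) * weight p T := by
  induction T generalizing p with
  | nil => cases p <;> simp [weight, rootImproper, topImproper, innerImproper]
  | cons a k r hk hr =>
    have hv : X 1 * pderiv 1 (vertexWeight p (min (a : WithTop ℕ) k.minLabel) r.minLabel)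
        = ((p.elim 0 fun c => (if ¬ r.minLabel ≤ min (a : WithTop ℕ) k.minLabel ∧
      min (a : WithTop ℕ) k.minLabel < (c : WithTop ℕ) then 1 else 0) : ℕ) :
        MvPolynomial (Fin 3) ℤ) * vertexWeight p (min (a : WithTop ℕ) k.minLabel) r.minLabel := by
      cases p with
      | none => unfold vertexWeight; split_ifs <;> simp [pderiv_X]
      | some i =>
        unfold vertexWeight
        by_cases h1 : r.minLabel ≤ min (a : WithTop ℕ) k.minLabel
        · simp only [h1, if_true]
          simp [pderiv_X]
        · by_cases h2 : min (a : WithTop ℕ) k.minLabel < (i : WithTop ℕ)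
          · simp only [Option.elim, h1, h2, not_false_eq_true, and_self, if_true, if_false]
            simp [pderiv_X]
          · simp only [Option.elim, h1, h2, and_false, if_false]
            simp
    have hs : rootImproper p (cons a k r) = (p.elim 0 fun c =>
        (if ¬ r.minLabel ≤ min (a : WithTop ℕ) k.minLabel ∧
      min (a : WithTop ℕ) k.minLabel < (c : WithTop ℕ) then 1 else 0)) + rootImproper p r := by
      cases p <;> simp [rootImproper, topImproper]
    have h1 := hk (some a)
    have h2 := hr p
    rw [hs]
    simp only [weight, innerImproper, Derivation.leibniz, smul_eq_mul]
    simp only [rootImproper, Option.elim] at h1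
    push_cast at h1 h2 ⊢
    linear_combination (weight (some a) k * weight p r) * hv +
      vertexWeight p (min (a : WithTop ℕ) k.minLabel) r.minLabel * weight p r * h1 +
      vertexWeight p (min (a : WithTop ℕ) k.minLabel) r.minLabel * weight (some a) k * h2

/-- Roots are never improper when there is no vertex above them, so the inner improper edges are all
of them and the Euler operator counts them. -/
theorem sum_weight_all_succ (n : ℕ) :
    ((all (n + 1)).map (weight none)).sum
      = (X 0 + (n : MvPolynomial (Fin 3) ℤ)) * ((all n).map (weight none)).sum
        + (X 1 + X 2) * ((n : MvPolynomial (Fin 3) ℤ) * ((all n).map (weight none)).sum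
          + X 1 * pderiv 1 ((all n).map (weight none)).sum) := by
  have h1 : ∀ T ∈ all n, ((insertions n T).map (weight none)).sum =
      (X 0 + (n : MvPolynomial (Fin 3) ℤ)) * weight none T + (X 1 + X 2) *
        ((n : MvPolynomial (Fin 3) ℤ) * weight none T + X 1 * pderiv 1 (weight none T)) := by
    intro T hT
    have hl := (mem_all n T).1 hT
    rw [sum_weight_insertions n none (by simp) T (by rw [hl]; simp), pderiv_weight, size_eq, hl]
    simp only [Option.elim, Multiset.card_range, rootImproper, zero_add]
    ring
  rw [all, List.map_flatMap, List.flatMap, List.sum_flatten, List.map_map]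
  have h2 : (all n).map (List.sum ∘ fun T => (insertions n T).map (weight none)) = (all n).map
      fun T => (X 0 + (n : MvPolynomial (Fin 3) ℤ)) * weight none T + (X 1 + X 2) *
        ((n : MvPolynomial (Fin 3) ℤ) * weight none T + X 1 * pderiv 1 (weight none T)) :=
    List.map_congr_left h1
  rw [h2, map_list_sum, List.map_map]
  induction all n with
  | nil => simp
  | cons T l ih =>
    simp only [List.map_cons, List.sum_cons, Function.comp] at ih ⊢
    rw [ih]
    ring

end LabeledForest

/-! ### Comparison with the polynomials `Q_n` -/

/-- Differentiation in `y` commutes with setting `z = 1`, as `y` is kept and no other variable is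
sent to an expression containing it. -/
theorem pderiv_aeval_chapoton (P : MvPolynomial (Fin 4) ℤ) :
    pderiv 1 (aeval (![X 0, X 1, 1, X 2] : Fin 4 → MvPolynomial (Fin 3) ℤ) P)
      = aeval (![X 0, X 1, 1, X 2] : Fin 4 → MvPolynomial (Fin 3) ℤ) (pderiv 1 P) := by
  induction P using MvPolynomial.induction_on with
  | C a => simp
  | add p q hp hq => simp only [map_add, hp, hq]
  | mul_X p i hp =>
    simp only [map_mul, Derivation.leibniz, smul_eq_mul, map_add, hp, aeval_X]
    fin_cases i <;> simp [pderiv_X]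

theorem chapotonQOne_succ (n : ℕ) : chapotonQOne (n + 2)
    = (X 0 + ((n + 1 : ℕ) : MvPolynomial (Fin 3) ℤ)) * chapotonQOne (n + 1)
      + (X 1 + X 2) * (((n + 1 : ℕ) : MvPolynomial (Fin 3) ℤ) * chapotonQOne (n + 1)
          + X 1 * pderiv 1 (chapotonQOne (n + 1))) := by
  unfold chapotonQOne
  rw [pderiv_aeval_chapoton, chapotonQ]
  simp

/-- The recursion operator differentiates only in `X 1`, so it commutes with multiplication by `X
0`. The factor `X 0` appears when the first label enters the empty forest. -/
theorem LabeledForest.sum_weight_all (n : ℕ) :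
    ((all (n + 1)).map (weight none)).sum = X 0 * chapotonQOne (n + 1) := by
  induction n with
  | zero =>
    rw [sum_weight_all_succ]
    simp [all, weight, chapotonQOne, chapotonQ]
  | succ n ih =>
    rw [sum_weight_all_succ, ih, chapotonQOne_succ]
    simp only [Derivation.leibniz, smul_eq_mul, pderiv_X]
    simp
    ring

/-! ### Smallest descendants with respect to a father function -/

section ParentFunction

variable {n : ℕ} (p : Fin n → Option (Fin n))

/-- `u` is the father of `w`. -/
def Father (u w : Fin n) : Prop := p w = some u

/-- The smallest descendant of `w`. -/
noncomputable def leastDesc (w : Fin n) : ℕ :=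
  sInf {a : ℕ | ∃ j : Fin n, ReflTransGen (Father p) w j ∧ (j : ℕ) = a}

variable {p}

theorem leastDesc_spec (w : Fin n) :
    ∃ j : Fin n, ReflTransGen (Father p) w j ∧ (j : ℕ) = leastDesc p w :=
  Nat.sInf_mem (s := {a : ℕ | ∃ j : Fin n, ReflTransGen (Father p) w j ∧ (j : ℕ) = a})
    ⟨w, w, .refl, rfl⟩

theorem leastDesc_le {w j : Fin n} (h : ReflTransGen (Father p) w j) : leastDesc p w ≤ j :=
  Nat.sInf_le ⟨j, h, rfl⟩

theorem father_wellFounded (hp : ∀ v, ¬ TransGen (Father p) v v) : WellFounded (Father p) := by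
  have : IsTrans (Fin n) (TransGen (Father p)) := ⟨fun _ _ _ => TransGen.trans⟩
  have : Std.Irrefl (TransGen (Father p)) := ⟨hp⟩
  exact Subrelation.wf (fun h => TransGen.single h)
    (Finite.wellFounded_of_trans_of_irrefl (TransGen (Father p)))

theorem father_swap_wellFounded (hp : ∀ v, ¬ TransGen (Father p) v v) :
    WellFounded (fun w u => Father p u w) := by
  have : IsTrans (Fin n) (fun w u => TransGen (Father p) u w) := ⟨fun _ _ _ h h' => h'.trans h⟩
  have : Std.Irrefl (fun w u => TransGen (Father p) u w) := ⟨hp⟩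
  exact Subrelation.wf (fun h => TransGen.single h)
    (Finite.wellFounded_of_trans_of_irrefl (fun w u => TransGen (Father p) u w))

/-- Fathers are unique, so the ancestors of `j` form a chain. -/
theorem desc_comparable {u v j : Fin n} (hu : ReflTransGen (Father p) u j)
    (hv : ReflTransGen (Father p) v j) :
    ReflTransGen (Father p) u v ∨ ReflTransGen (Father p) v u := by
  induction hu with
  | refl => exact Or.inr hv
  | tail h1 h2 ih =>
    rcases ReflTransGen.cases_tail hv with rfl | ⟨c, hc, hc'⟩
    · exact Or.inl (h1.tail h2)
    · have : c = _ := Option.some.inj (hc'.symm.trans h2)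
      exact ih (this ▸ hc)

theorem sibling_eq_of_desc (hp : ∀ v, ¬ TransGen (Father p) v v) {u v : Fin n} (h : p u = p v)
    (huv : ReflTransGen (Father p) u v) : u = v := by
  rcases ReflTransGen.cases_tail huv with rfl | ⟨c, hc, hc'⟩
  · rfl
  · exact absurd (TransGen.head' (show Father p c u from h.trans hc') hc) (hp c)

/-- The shared value is a common descendant, and siblings with a common descendant coincide. -/
theorem leastDesc_inj (hp : ∀ v, ¬ TransGen (Father p) v v) {u v : Fin n} (h : p u = p v)
    (huv : leastDesc p u = leastDesc p v) : u = v := by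
  obtain ⟨j, hj, hj'⟩ := leastDesc_spec (p := p) u
  obtain ⟨k, hk, hk'⟩ := leastDesc_spec (p := p) v
  have : j = k := Fin.ext (hj'.trans (huv.trans hk'.symm))
  subst this
  rcases desc_comparable hj hk with h1 | h1
  · exact sibling_eq_of_desc hp h h1
  · exact (sibling_eq_of_desc hp h.symm h1).symm

/-- Equality would make the father its own proper descendant. This reconciles the weak inequality
for improper edges of plane trees with the strict one for half-mobile trees. -/
theorem leastDesc_ne_father (hp : ∀ v, ¬ TransGen (Father p) v v) {u w : Fin n}
    (h : p w = some u) : leastDesc p w ≠ u := by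
  intro he
  obtain ⟨j, hj, hj'⟩ := leastDesc_spec (p := p) w
  have : j = u := Fin.ext (hj'.trans he)
  subst this
  exact hp j (TransGen.head' h hj)

end ParentFunction

/-! ### Plane trees with the smallest root removed -/

/-- A forest on `Fin n` in which the roots and the children of each vertex are linearly ordered,
given by the parent function and the lists of children (of roots at `none`). -/
structure OrderedForest (n : ℕ) where
  parent : Fin n → Option (Fin n)
  children : Option (Fin n) → List (Fin n)
  acyclic : ∀ v, ¬ TransGen (Father parent) v v
  nodup : ∀ i, (children i).Nodup
  mem_children : ∀ i w, w ∈ children i ↔ parent w = i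

/-- The father of a vertex of `Fin n` as a vertex of `Fin (n + 1)`. -/
def optionToFin {n : ℕ} (i : Option (Fin n)) : Fin (n + 1) := i.elim 0 Fin.succ

/-- The inverse of `optionToFin`. -/
def finToOption {n : ℕ} (v : Fin (n + 1)) : Option (Fin n) :=
  Fin.cases (motive := fun _ => Option (Fin n)) none some v

@[simp] theorem finToOption_zero {n : ℕ} : finToOption (0 : Fin (n + 1)) = none := rfl
@[simp] theorem finToOption_succ {n : ℕ} (w : Fin n) : finToOption w.succ = some w := rfl
@[simp] theorem optionToFin_none {n : ℕ} : optionToFin (none : Option (Fin n)) = 0 := rfl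
@[simp] theorem optionToFin_some {n : ℕ} (w : Fin n) : optionToFin (some w) = w.succ := rfl

@[simp] theorem optionToFin_finToOption {n : ℕ} (v : Fin (n + 1)) :
    optionToFin (finToOption v) = v := by
  refine Fin.cases ?_ (fun _ => ?_) v <;> rfl

@[simp] theorem finToOption_optionToFin {n : ℕ} (i : Option (Fin n)) :
    finToOption (optionToFin i) = i := by
  cases i <;> rfl

namespace OrderedForest

variable {n : ℕ} (A : OrderedForest n)

/-- The smallest descendant. -/
noncomputable abbrev least (w : Fin n) : ℕ := leastDesc A.parent w

/-- `w` has a brother to its right with a smaller descendant. -/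
def Elder (w : Fin n) : Prop :=
  ∃ k, [w, k].Sublist (A.children (A.parent w)) ∧ A.least k < A.least w

/-- The plane tree with a new smallest root. -/
def toPlaneTree : PlaneTree (n + 1) where
  root := 0
  children v := (A.children (finToOption v)).map Fin.succ
  nodup v := (A.nodup _).map (Fin.succ_injective n)
  root_notMem v := by simp [Fin.succ_ne_zero]
  parent_unique u u' v h h' := by
    simp only [List.mem_map] at h h'
    obtain ⟨w, hw, rfl⟩ := h
    obtain ⟨w', hw', he⟩ := h'
    rw [Fin.succ_inj] at he
    subst he
    rw [A.mem_children] at hw hw'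
    rw [← optionToFin_finToOption u, ← hw, hw', optionToFin_finToOption]
  reachable v := by
    refine Fin.cases .refl (fun w => ?_) v
    induction w using (father_wellFounded A.acyclic).induction with
    | _ w ih =>
      have hw : w ∈ A.children (A.parent w) := (A.mem_children _ _).2 rfl
      cases hp : A.parent w with
      | none =>
        refine .single ?_
        rw [hp] at hw
        simpa using hw
      | some u =>
        refine .tail (ih u hp) ?_
        rw [hp] at hw
        simpa using hw

theorem mem_toPlaneTree_children (v : Fin (n + 1)) (w : Fin n) :
    w.succ ∈ A.toPlaneTree.children v ↔ A.parent w = finToOption v := by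
  simp [toPlaneTree, A.mem_children]

theorem zero_notMem_toPlaneTree_children (v : Fin (n + 1)) : 0 ∉ A.toPlaneTree.children v :=
  A.toPlaneTree.root_notMem v

theorem ext_children {A B : OrderedForest n} (hc : A.children = B.children) : A = B := by
  have hp : A.parent = B.parent := by
    funext w
    have h1 := (A.mem_children _ _).2 (rfl : A.parent w = _)
    rw [hc, B.mem_children] at h1
    exact h1.symm
  cases A; cases B
  simp only at hc hp
  subst hc hp
  rfl

theorem toPlaneTree_injective : Function.Injective (toPlaneTree (n := n)) := by
  intro A B h
  refine ext_children ?_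
  funext i
  have := congrArg (fun T => T.children (optionToFin i)) h
  simp only [toPlaneTree, finToOption_optionToFin] at this
  exact (Fin.succ_injective n).list_map this

theorem exists_toPlaneTree_eq (T : PlaneTree (n + 1)) (hT : T.root = 0) :
    ∃ A : OrderedForest n, A.toPlaneTree = T := by
  -- Reachability from the root gives accessibility of every vertex by induction along the path;
  -- this is the source of acyclicity.
  have hwf : WellFounded (fun u w => w ∈ T.children u) := by
    refine ⟨fun v => ?_⟩
    induction T.reachable v with
    | refl => exact ⟨_, fun u hu => absurd hu (T.root_notMem u)⟩
    | tail _ h ih => exact ⟨_, fun u hu => T.parent_unique _ _ _ h hu ▸ ih⟩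
  have hpar : ∀ w : Fin n, ∃ u, w.succ ∈ T.children u := by
    intro w
    rcases ReflTransGen.cases_tail (T.reachable w.succ) with h | ⟨c, _, hc⟩
    · rw [hT] at h; exact absurd h (Fin.succ_ne_zero w)
    · exact ⟨c, hc⟩
  choose f hf using hpar
  have hf' : ∀ w u, w.succ ∈ T.children u ↔ f w = u :=
    fun w u => ⟨fun h => T.parent_unique _ _ _ (hf w) h, fun h => h ▸ hf w⟩
  have hmap : ∀ v, ((T.children v).filterMap finToOption).map Fin.succ = T.children v := by
    intro v
    have h0 : 0 ∉ T.children v := hT ▸ T.root_notMem v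
    rw [List.map_filterMap]
    conv_rhs => rw [← List.filterMap_some (l := T.children v)]
    refine List.filterMap_congr fun x hx => ?_
    induction x using Fin.cases with
    | zero => exact absurd hx h0
    | succ x => rfl
  refine ⟨⟨fun w => finToOption (f w),
    fun i => (T.children (optionToFin i)).filterMap finToOption, ?_, ?_, ?_⟩, ?_⟩
  · intro v hv
    have : TransGen (fun u w => w ∈ T.children u) v.succ v.succ := by
      refine TransGen.lift (p := fun u w => w ∈ T.children u) Fin.succ ?_ _ _ hv
      intro a b hab
      change b.succ ∈ T.children a.succ
      rw [hf', ← optionToFin_finToOption (f b), show finToOption (f b) = some a from hab]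
      rfl
    exact hwf.transGen.irrefl.irrefl _ this
  · intro i
    refine List.Nodup.of_map Fin.succ ?_
    rw [hmap]
    exact T.nodup _
  · intro i w
    rw [← List.mem_map_of_injective (Fin.succ_injective n), hmap, hf']
    constructor
    · intro h; simp [h]
    · intro h; rw [← h]; simp
  · have hch : (fun v => ((T.children (optionToFin (finToOption v))).filterMap finToOption).map
        Fin.succ) = T.children := by
      funext v
      rw [optionToFin_finToOption, hmap]
    cases T with
    | mk root children h1 h2 h3 h4 =>
    simp only at hT hch
    subst hT
    simp only [toPlaneTree, PlaneTree.mk.injEq, true_and]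
    exact hch

/-- Ordered forests on `Fin n` are plane trees on `Fin (n + 1)` with root `0`. -/
noncomputable def equivPlaneTree (n : ℕ) :
    OrderedForest n ≃ {T : PlaneTree (n + 1) // T.root = 0} :=
  Equiv.ofBijective (fun A => ⟨A.toPlaneTree, rfl⟩)
    ⟨fun A B h => toPlaneTree_injective (congrArg Subtype.val h), fun T => by
      obtain ⟨A, hA⟩ := exists_toPlaneTree_eq T.1 T.2
      exact ⟨A, Subtype.ext hA⟩⟩

theorem toPlaneTree_desc (u : Fin n) (v : Fin (n + 1)) :
    A.toPlaneTree.Desc u.succ v ↔ ∃ w : Fin n, v = w.succ ∧ ReflTransGen (Father A.parent) u w := by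
  constructor
  · intro h
    induction h with
    | refl => exact ⟨u, rfl, .refl⟩
    | tail _ h ih =>
      obtain ⟨w, rfl, hw⟩ := ih
      rename_i c _
      induction c using Fin.cases with
      | zero => exact absurd h (A.zero_notMem_toPlaneTree_children _)
      | succ c => exact ⟨c, rfl, hw.tail ((A.mem_toPlaneTree_children _ _).1 h)⟩
  · rintro ⟨w, rfl, hw⟩
    refine ReflTransGen.lift (p := fun u w => w ∈ A.toPlaneTree.children u) Fin.succ ?_ _ _ hw
    intro a b hab
    exact (A.mem_toPlaneTree_children _ _).2 hab

theorem toPlaneTree_beta (u : Fin n) : A.toPlaneTree.beta u.succ = A.least u + 1 := by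
  refine le_antisymm ?_ ?_
  · obtain ⟨j, hj, hj'⟩ := leastDesc_spec (p := A.parent) u
    refine Nat.sInf_le ⟨j.succ, (A.toPlaneTree_desc _ _).2 ⟨j, rfl, hj⟩, ?_⟩
    rw [Fin.val_succ, hj']
  · refine le_csInf ⟨_, u.succ, .refl, rfl⟩ ?_
    rintro a ⟨j, hj, rfl⟩
    obtain ⟨w, rfl, hw⟩ := (A.toPlaneTree_desc _ _).1 hj
    rw [Fin.val_succ]
    exact Nat.succ_le_succ (leastDesc_le hw)

theorem toPlaneTree_elder (w : Fin n) : A.toPlaneTree.Elder w.succ ↔ A.Elder w := by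
  constructor
  · rintro ⟨i, k, hs, hk⟩
    have hw : w.succ ∈ A.toPlaneTree.children i := hs.subset (by simp)
    have hk' : k ∈ A.toPlaneTree.children i := hs.subset (by simp)
    induction k using Fin.cases with
    | zero => exact absurd hk' (A.zero_notMem_toPlaneTree_children _)
    | succ k =>
      rw [mem_toPlaneTree_children] at hw
      refine ⟨k, ?_, by simpa [toPlaneTree_beta] using hk⟩
      rw [hw]
      obtain ⟨l, hl, hl'⟩ := List.sublist_map_iff.1 hs
      have : l = [w, k] := (Fin.succ_injective n).list_map hl'.symm
      exact this ▸ hl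
  · rintro ⟨k, hs, hk⟩
    refine ⟨optionToFin (A.parent w), k.succ, ?_, by simpa [toPlaneTree_beta] using hk⟩
    simp only [toPlaneTree, finToOption_optionToFin]
    exact hs.map Fin.succ

theorem not_toPlaneTree_elder_zero : ¬ A.toPlaneTree.Elder 0 := by
  rintro ⟨i, k, hs, -⟩
  exact A.zero_notMem_toPlaneTree_children i (hs.subset (by simp))

theorem toPlaneTree_eld : A.toPlaneTree.eld = {w | A.Elder w}.ncard := by
  symm
  refine Set.ncard_congr (fun w _ => w.succ) (fun w hw => (A.toPlaneTree_elder w).2 hw)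
    (fun a b _ _ h => Fin.succ_injective n h) ?_
  intro v hv
  induction v using Fin.cases with
  | zero => exact absurd hv A.not_toPlaneTree_elder_zero
  | succ v => exact ⟨v, (A.toPlaneTree_elder v).1 hv, rfl⟩

theorem toPlaneTree_young :
    A.toPlaneTree.young 0 = {w | ¬ A.Elder w ∧ A.parent w = none}.ncard := by
  have h1 : A.toPlaneTree.deg 0 = {w | A.parent w = none}.ncard := by
    have : {w | A.parent w = none} = ((A.children none).toFinset : Set (Fin n)) := by
      ext w
      simp [A.mem_children]
    rw [this, Set.ncard_coe_finset, List.toFinset_card_of_nodup (A.nodup _)]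
    simp [PlaneTree.deg, toPlaneTree]
  have h2 : A.toPlaneTree.eldAt 0 = {w | A.parent w = none ∧ A.Elder w}.ncard := by
    symm
    refine Set.ncard_congr (fun w _ => w.succ) (fun w hw =>
      ⟨(A.mem_toPlaneTree_children _ _).2 hw.1, (A.toPlaneTree_elder w).2 hw.2⟩)
      (fun a b _ _ h => Fin.succ_injective n h) ?_
    intro v hv
    induction v using Fin.cases with
    | zero => exact absurd hv.2 A.not_toPlaneTree_elder_zero
    | succ v => exact ⟨v, ⟨(A.mem_toPlaneTree_children _ _).1 hv.1,
        (A.toPlaneTree_elder v).1 hv.2⟩, rfl⟩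
  rw [PlaneTree.young, h1, h2, ← Set.ncard_sdiff (fun w hw => hw.1)]
  congr 1
  ext w
  simp only [Set.mem_sdiff, Set.mem_ofPred_eq]
  tauto

/-- An edge is determined by its lower end, so vertices are counted. Edges at the root `0` drop out
since every smallest descendant there is at least 1, and `leastDesc_ne_father` makes the inequality
strict. -/
theorem toPlaneTree_imp : A.toPlaneTree.imp =
    {w | ¬ A.Elder w ∧ ∃ i, A.parent w = some i ∧ A.least w < i}.ncard := by
  symm
  refine Set.ncard_congr (fun w _ => (optionToFin (A.parent w), w.succ)) ?_
    (fun a b _ _ h => Fin.succ_injective n (Prod.mk.inj h).2) ?_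
  · rintro w ⟨h1, i, hi, h2⟩
    refine ⟨(A.mem_toPlaneTree_children _ _).2 (by simp), ?_⟩
    rw [toPlaneTree_elder, toPlaneTree_beta, hi, optionToFin_some, Fin.val_succ, not_or]
    exact ⟨h1, by omega⟩
  · rintro ⟨i, v⟩ ⟨h1, h2⟩
    simp only at h1 h2
    induction v using Fin.cases with
    | zero => exact absurd h1 (A.zero_notMem_toPlaneTree_children _)
    | succ w =>
      rw [mem_toPlaneTree_children] at h1
      rw [toPlaneTree_elder, toPlaneTree_beta, not_or] at h2
      obtain ⟨h2, h3⟩ := h2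
      induction i using Fin.cases with
      | zero => simp at h3
      | succ i =>
        rw [finToOption_succ] at h1
        have h4 : A.least w ≠ i := leastDesc_ne_father A.acyclic h1
        rw [Fin.val_succ] at h3
        refine ⟨w, ⟨h2, i, h1, by omega⟩, ?_⟩
        rw [h1]; rfl

end OrderedForest

/-! ### Ordered forests as inductive plane forests -/

theorem List.pair_sublist_iff_mem {α : Type*} {l₀ l : List α} {v k : α}
    (h : (l₀ ++ v :: l).Nodup) : [v, k].Sublist (l₀ ++ v :: l) ↔ k ∈ l := by
  constructor
  · intro hs
    obtain ⟨a, b, hab, ha, hb⟩ := List.sublist_append_iff.1 hs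
    cases a with
    | nil =>
      rw [List.nil_append] at hab
      rw [← hab, List.cons_sublist_cons, List.singleton_sublist] at hb
      exact hb
    | cons x a =>
      have hx : x = v := by
        rw [List.cons_append] at hab
        exact (List.cons.inj hab).1.symm
      have : v ∈ l₀ := hx ▸ ha.subset (by simp)
      exact absurd rfl ((List.nodup_append.1 h).2.2 v this v (by simp))
  · intro hk
    exact (List.Sublist.cons_cons v (List.singleton_sublist.2 hk)).trans
      (List.sublist_append_right _ _)

namespace LabeledForest

/-- `F` is the plane forest below the vertices of the list `l`. -/
def Represents {n : ℕ} (ch : Option (Fin n) → List (Fin n)) :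
    LabeledForest → List (Fin n) → Prop
  | nil, l => l = []
  | cons a k r, l => ∃ v l', l = v :: l' ∧ (v : ℕ) = a ∧ Represents ch k (ch (some v)) ∧
      Represents ch r l'

/-- The labels of the roots. -/
def tops : LabeledForest → List ℕ
  | nil => []
  | cons a _ r => a :: tops r

/-- The labels of the children of `u`. -/
def kids (u : ℕ) : LabeledForest → List ℕ
  | nil => []
  | cons a k r => if u = a then tops k else kids u k ++ kids u r

/-- The depth of `w`, if the roots have depth `d`. -/
def depth (w : ℕ) : ℕ → LabeledForest → ℕ
  | d, nil => d
  | d, cons a k r => if w = a then d else if w ∈ k.labels then depth w (d + 1) k else depth w d r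

theorem tops_le (F : LabeledForest) : (F.tops : Multiset ℕ) ≤ F.labels := by
  induction F with
  | nil => simp [tops]
  | cons a k r _ hr =>
    rw [tops, labels, ← Multiset.cons_coe]
    exact Multiset.cons_le_cons a (hr.trans (Multiset.le_add_left _ _))

theorem mem_labels_of_mem_tops {F : LabeledForest} {w : ℕ} (h : w ∈ F.tops) : w ∈ F.labels :=
  Multiset.mem_of_le F.tops_le (Multiset.mem_coe.2 h)

theorem nodup_tops {F : LabeledForest} (h : F.labels.Nodup) : F.tops.Nodup :=
  Multiset.coe_nodup.1 (Multiset.nodup_of_le F.tops_le h)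

theorem mem_labels_of_mem_kids {F : LabeledForest} {u w : ℕ} (h : w ∈ kids u F) :
    w ∈ F.labels ∧ u ∈ F.labels := by
  induction F with
  | nil => simp [kids] at h
  | cons a k r hk hr =>
    simp only [kids] at h
    simp only [labels, Multiset.mem_cons, Multiset.mem_add]
    split_ifs at h with hu
    · exact ⟨Or.inr (Or.inl (mem_labels_of_mem_tops h)), Or.inl hu⟩
    · rw [List.mem_append] at h
      rcases h with h | h
      · have := hk h; tauto
      · have := hr h; tauto

theorem mem_tops_or_kids {F : LabeledForest} {w : ℕ} (h : w ∈ F.labels) (hF : F.labels.Nodup) :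
    w ∈ F.tops ∨ ∃ u, w ∈ kids u F := by
  induction F with
  | nil => simp [labels] at h
  | cons a k r hk hr =>
    simp only [labels, Multiset.mem_cons, Multiset.mem_add, Multiset.nodup_cons,
      Multiset.nodup_add, not_or] at h hF
    obtain ⟨⟨h1, h1'⟩, h2, h3, h4⟩ := hF
    rcases h with rfl | h | h
    · simp [tops]
    · rcases hk h h2 with h | ⟨u, hu⟩
      · exact Or.inr ⟨a, by simp [kids, h]⟩
      · refine Or.inr ⟨u, ?_⟩
        have : u ≠ a := fun he => h1 (he ▸ (mem_labels_of_mem_kids hu).2)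
        simp [kids, this, hu]
    · rcases hr h h3 with h | ⟨u, hu⟩
      · exact Or.inl (by simp [tops, h])
      · refine Or.inr ⟨u, ?_⟩
        have : u ≠ a := fun he => h1' (he ▸ (mem_labels_of_mem_kids hu).2)
        simp [kids, this, hu]

theorem notMem_kids_of_mem_tops {F : LabeledForest} (hF : F.labels.Nodup) {u w : ℕ}
    (h : w ∈ F.tops) : w ∉ kids u F := by
  induction F with
  | nil => simp [kids]
  | cons a k r hk hr =>
    simp only [labels, Multiset.mem_add, Multiset.nodup_cons, Multiset.nodup_add, not_or] at hF
    obtain ⟨⟨h1, h1'⟩, h2, h3, h4⟩ := hF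
    intro h'
    simp only [kids] at h'
    simp only [tops, List.mem_cons] at h
    rcases h with rfl | h
    · split_ifs at h' with hu
      · exact h1 (mem_labels_of_mem_tops h')
      · rw [List.mem_append] at h'
        rcases h' with h' | h'
        · exact h1 (mem_labels_of_mem_kids h').1
        · exact h1' (mem_labels_of_mem_kids h').1
    · have hw := mem_labels_of_mem_tops h
      split_ifs at h' with hu
      · exact Multiset.disjoint_left.1 h4 (mem_labels_of_mem_tops h') hw
      · rw [List.mem_append] at h'
        rcases h' with h' | h'
        · exact Multiset.disjoint_left.1 h4 (mem_labels_of_mem_kids h').1 hw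
        · exact hr h3 h h'

theorem kids_unique {F : LabeledForest} (hF : F.labels.Nodup) {u u' w : ℕ}
    (h : w ∈ kids u F) (h' : w ∈ kids u' F) : u = u' := by
  induction F with
  | nil => simp [kids] at h
  | cons a k r hk hr =>
    simp only [labels, Multiset.mem_add, Multiset.nodup_cons, Multiset.nodup_add, not_or] at hF
    obtain ⟨⟨h1, h1'⟩, h2, h3, h4⟩ := hF
    simp only [kids] at h h'
    split_ifs at h h' with hu hu' hu'
    · rw [hu, hu']
    · rw [List.mem_append] at h'
      rcases h' with h' | h'
      · exact absurd h' (notMem_kids_of_mem_tops h2 h)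
      · exact absurd (mem_labels_of_mem_kids h').1
          (Multiset.disjoint_left.1 h4 (mem_labels_of_mem_tops h))
    · rw [List.mem_append] at h
      rcases h with h | h
      · exact absurd h (notMem_kids_of_mem_tops h2 h')
      · exact absurd (mem_labels_of_mem_kids h).1
          (Multiset.disjoint_left.1 h4 (mem_labels_of_mem_tops h'))
    · rw [List.mem_append] at h h'
      rcases h with h | h <;> rcases h' with h' | h'
      · exact hk h2 h h'
      · exact absurd (mem_labels_of_mem_kids h').1
          (Multiset.disjoint_left.1 h4 (mem_labels_of_mem_kids h).1)
      · exact absurd (mem_labels_of_mem_kids h).1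
          (Multiset.disjoint_left.1 h4 (mem_labels_of_mem_kids h').1)
      · exact hr h3 h h'

theorem nodup_kids {F : LabeledForest} (hF : F.labels.Nodup) (u : ℕ) : (kids u F).Nodup := by
  induction F with
  | nil => simp [kids]
  | cons a k r hk hr =>
    simp only [labels, Multiset.mem_add, Multiset.nodup_cons, Multiset.nodup_add, not_or] at hF
    obtain ⟨⟨h1, h1'⟩, h2, h3, h4⟩ := hF
    rw [kids]
    split_ifs
    · exact nodup_tops h2
    · refine List.nodup_append.2 ⟨hk h2, hr h3, ?_⟩
      rintro x hx _ hy rfl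
      exact Multiset.disjoint_left.1 h4 (mem_labels_of_mem_kids hx).1 (mem_labels_of_mem_kids hy).1

theorem depth_of_mem_tops {F : LabeledForest} (hF : F.labels.Nodup) {w d : ℕ} (h : w ∈ F.tops) :
    depth w d F = d := by
  induction F with
  | nil => rfl
  | cons a k r _ hr =>
    simp only [labels, Multiset.mem_add, Multiset.nodup_cons, Multiset.nodup_add, not_or] at hF
    obtain ⟨⟨h1, h1'⟩, h2, h3, h4⟩ := hF
    simp only [tops, List.mem_cons] at h
    rw [depth]
    split_ifs with hw hk
    · rfl
    · rcases h with h | h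
      · exact absurd h hw
      · exact absurd (mem_labels_of_mem_tops h) (Multiset.disjoint_left.1 h4 hk)
    · exact hr h3 (h.resolve_left hw)

/-- The depth is a rank function: it shows that the father function read off from a labeled forest
has no cycles. -/
theorem depth_of_mem_kids {F : LabeledForest} (hF : F.labels.Nodup) {u w d : ℕ}
    (h : w ∈ kids u F) : depth w d F = depth u d F + 1 := by
  induction F generalizing d with
  | nil => simp [kids] at h
  | cons a k r hk hr =>
    simp only [labels, Multiset.mem_add, Multiset.nodup_cons, Multiset.nodup_add, not_or] at hF
    obtain ⟨⟨h1, h1'⟩, h2, h3, h4⟩ := hF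
    simp only [kids] at h
    split_ifs at h with hu
    · have hw := mem_labels_of_mem_tops h
      have hwa : w ≠ a := fun he => h1 (he ▸ hw)
      rw [depth, if_neg hwa, if_pos hw, depth, if_pos hu, depth_of_mem_tops h2 h]
    · rw [List.mem_append] at h
      rcases h with h | h
      · obtain ⟨hw, hu'⟩ := mem_labels_of_mem_kids h
        have hwa : w ≠ a := fun he => h1 (he ▸ hw)
        rw [depth, if_neg hwa, if_pos hw, depth, if_neg hu, if_pos hu', hk h2 h]
      · obtain ⟨hw, hu'⟩ := mem_labels_of_mem_kids h
        have hwa : w ≠ a := fun he => h1' (he ▸ hw)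
        rw [depth, if_neg hwa, if_neg fun h => Multiset.disjoint_left.1 h4 h hw, depth, if_neg hu,
          if_neg fun h => Multiset.disjoint_left.1 h4 h hu', hr h3 h]

/-- With distinct labels a vertex lies in only one of the two subforests, so the other one
contributes nothing to its list of children. -/
theorem represents_of_kids {n : ℕ} {ch : Option (Fin n) → List (Fin n)} {F : LabeledForest}
    (hF : F.labels.Nodup) (l : List (Fin n)) (hl : l.map Fin.val = F.tops)
    (h : ∀ v : Fin n, (v : ℕ) ∈ F.labels → (ch (some v)).map Fin.val = kids v F) :
    Represents ch F l := by
  induction F generalizing l with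
  | nil => simpa [tops, Represents] using hl
  | cons a k r hk hr =>
    simp only [labels, Multiset.mem_add, Multiset.nodup_cons, Multiset.nodup_add, not_or] at hF
    obtain ⟨⟨h1, h1'⟩, h2, h3, h4⟩ := hF
    cases l with
    | nil => simp [tops] at hl
    | cons v l =>
      simp only [tops, List.map_cons, List.cons.injEq] at hl
      obtain ⟨rfl, hl⟩ := hl
      refine ⟨v, l, rfl, rfl, hk h2 _ ?_ fun u hu => ?_, hr h3 _ hl fun u hu => ?_⟩
      · rw [h v (by simp [labels]), kids, if_pos rfl]
      · have hne : (u : ℕ) ≠ v := fun he => h1 (he ▸ hu)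
        have h0 : kids u r = [] := List.eq_nil_iff_forall_not_mem.2 fun w hw =>
          Multiset.disjoint_left.1 h4 hu (mem_labels_of_mem_kids hw).2
        rw [h u (by simp [labels, hu]), kids, if_neg hne, h0, List.append_nil]
      · have hne : (u : ℕ) ≠ v := fun he => h1' (he ▸ hu)
        have h0 : kids u k = [] := List.eq_nil_iff_forall_not_mem.2 fun w hw =>
          Multiset.disjoint_left.1 h4 (mem_labels_of_mem_kids hw).2 hu
        rw [h u (by simp [labels, hu]), kids, if_neg hne, h0, List.nil_append]

end LabeledForest

theorem List.exists_map_val_eq {n : ℕ} (l : List ℕ) (h : ∀ a ∈ l, a < n) :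
    ∃ l' : List (Fin n), l'.map Fin.val = l :=
  ⟨l.pmap (fun a ha => ⟨a, ha⟩) h, by rw [List.map_pmap]; simp⟩

namespace OrderedForest

open LabeledForest

variable {n : ℕ} (A : OrderedForest n)

/-- Recursion from the leaves upwards, along the relation "is a child of", which is well founded
because the forest is finite and acyclic. -/
theorem exists_represents : ∃ F, Represents A.children F (A.children none) := by
  have hlist : ∀ l : List (Fin n), (∀ v ∈ l, ∃ k, Represents A.children k (A.children (some v))) →
      ∃ F, Represents A.children F l := by
    intro l
    induction l with
    | nil => exact fun _ => ⟨nil, rfl⟩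
    | cons v l ih =>
      intro h
      obtain ⟨k, hk⟩ := h v (by simp)
      obtain ⟨r, hr⟩ := ih fun u hu => h u (by simp [hu])
      exact ⟨cons v k r, v, l, rfl, rfl, hk, hr⟩
  have hv : ∀ v, ∃ k, Represents A.children k (A.children (some v)) := by
    intro v
    induction v using (father_swap_wellFounded A.acyclic).induction with
    | _ v ih => exact hlist _ fun u hu => ih u ((A.mem_children _ _).1 hu)
  exact hlist _ fun v _ => hv v

/-- The plane forest of an ordered forest. -/
noncomputable def toLabeled : LabeledForest := A.exists_represents.choose

theorem represents_toLabeled : Represents A.children A.toLabeled (A.children none) :=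
  A.exists_represents.choose_spec

variable {A}

theorem mem_labels_iff {F : LabeledForest} {l : List (Fin n)} (h : Represents A.children F l)
    (a : ℕ) : a ∈ F.labels ↔
      ∃ v ∈ l, ∃ j : Fin n, ReflTransGen (Father A.parent) v j ∧ (j : ℕ) = a := by
  induction F generalizing l with
  | nil => simp [show l = [] from h, labels]
  | cons b k r hk hr =>
    obtain ⟨v, l', rfl, rfl, h1, h2⟩ := h
    simp only [labels, Multiset.mem_cons, Multiset.mem_add, hk h1, hr h2, List.mem_cons,
      exists_eq_or_imp]
    rw [← or_assoc]
    refine or_congr ⟨?_, ?_⟩ Iff.rfl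
    · rintro (rfl | ⟨u, hu, j, hj, rfl⟩)
      · exact ⟨v, .refl, rfl⟩
      · exact ⟨j, .head ((A.mem_children _ _).1 hu) hj, rfl⟩
    · rintro ⟨j, hj, rfl⟩
      rcases ReflTransGen.cases_head hj with rfl | ⟨c, hc, hc'⟩
      · exact Or.inl rfl
      · exact Or.inr ⟨c, (A.mem_children _ _).2 hc, j, hc', rfl⟩

/-- Different siblings have no common descendants. The list `l` is a suffix of a full sibling list,
the form that persists when passing to the right part. -/
theorem nodup_labels {F : LabeledForest} {l₀ l : List (Fin n)} {i : Option (Fin n)}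
    (hl : A.children i = l₀ ++ l) (h : Represents A.children F l) : F.labels.Nodup := by
  induction F generalizing l₀ l i with
  | nil => simp [labels]
  | cons b k r hk hr =>
    obtain ⟨v, l', rfl, rfl, h1, h2⟩ := h
    have hl' : A.children i = (l₀ ++ [v]) ++ l' := by simp [hl]
    have hv : A.parent v = i := by rw [← A.mem_children, hl]; simp
    have hsib : ∀ u ∈ l', ∀ j, ReflTransGen (Father A.parent) v j →
        ¬ ReflTransGen (Father A.parent) u j := by
      intro u hu j hj hj'
      have hpu : A.parent u = i := by rw [← A.mem_children, hl]; simp [hu]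
      have : v = u := by
        rcases desc_comparable hj hj' with h | h
        · exact sibling_eq_of_desc A.acyclic (hv.trans hpu.symm) h
        · exact (sibling_eq_of_desc A.acyclic (hpu.trans hv.symm) h).symm
      subst this
      have := A.nodup i
      rw [hl, List.nodup_append, List.nodup_cons] at this
      exact this.2.1.1 hu
    simp only [labels, Multiset.mem_add, Multiset.nodup_cons, Multiset.nodup_add, not_or]
    refine ⟨⟨?_, ?_⟩, hk (l₀ := []) rfl h1, hr hl' h2, ?_⟩
    · rw [mem_labels_iff h1]
      rintro ⟨u, hu, j, hj, he⟩
      obtain rfl := Fin.ext he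
      exact A.acyclic _ (TransGen.head' ((A.mem_children _ _).1 hu) hj)
    · rw [mem_labels_iff h2]
      rintro ⟨u, hu, j, hj, he⟩
      obtain rfl := Fin.ext he
      exact hsib u hu _ .refl hj
    · rw [Multiset.disjoint_left]
      intro a ha ha'
      rw [mem_labels_iff h1] at ha
      rw [mem_labels_iff h2] at ha'
      obtain ⟨u, hu, j, hj, rfl⟩ := ha
      obtain ⟨u', hu', j', hj', he⟩ := ha'
      obtain rfl := Fin.ext he
      exact hsib u' hu' _ (.head ((A.mem_children _ _).1 hu) hj) hj'

theorem labels_toLabeled : A.toLabeled.labels = Multiset.range n := by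
  refine (Multiset.Nodup.ext (nodup_labels (l₀ := []) rfl A.represents_toLabeled)
    (Multiset.nodup_range n)).2 fun a => ?_
  rw [mem_labels_iff A.represents_toLabeled, Multiset.mem_range]
  constructor
  · rintro ⟨_, _, j, _, rfl⟩
    exact j.2
  · intro ha
    suffices h : ∀ w : Fin n, ∃ v ∈ A.children none, ReflTransGen (Father A.parent) v w by
      obtain ⟨v, hv, hv'⟩ := h ⟨a, ha⟩
      exact ⟨v, hv, _, hv', rfl⟩
    intro w
    induction w using (father_wellFounded A.acyclic).induction with
    | _ w ih =>
      cases hp : A.parent w with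
      | none => exact ⟨w, (A.mem_children _ _).2 hp, .refl⟩
      | some u =>
        obtain ⟨v, hv, hv'⟩ := ih u hp
        exact ⟨v, hv, hv'.tail hp⟩

theorem children_eq_of_represents {B : OrderedForest n} {F : LabeledForest} {l l' : List (Fin n)}
    (h : Represents A.children F l) (h' : Represents B.children F l') :
    l = l' ∧ ∀ v : Fin n, (v : ℕ) ∈ F.labels → A.children (some v) = B.children (some v) := by
  induction F generalizing l l' with
  | nil => exact ⟨(show l = [] from h).trans (show l' = [] from h').symm, by simp [labels]⟩
  | cons a k r hk hr =>
    obtain ⟨v, m, rfl, rfl, h1, h2⟩ := h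
    obtain ⟨v', m', rfl, he, h1', h2'⟩ := h'
    obtain rfl := Fin.ext he
    obtain ⟨h3, h4⟩ := hk h1 h1'
    obtain ⟨h5, h6⟩ := hr h2 h2'
    refine ⟨by rw [h5], fun u hu => ?_⟩
    simp only [labels, Multiset.mem_cons, Multiset.mem_add] at hu
    rcases hu with hu | hu | hu
    · obtain rfl := Fin.ext hu
      exact h3
    · exact h4 u hu
    · exact h6 u hu

theorem toLabeled_injective : Function.Injective (toLabeled (n := n)) := by
  intro A B h
  have hB := B.represents_toLabeled
  rw [← h] at hB
  obtain ⟨h1, h2⟩ := children_eq_of_represents A.represents_toLabeled hB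
  refine ext_children ?_
  funext i
  cases i with
  | none => exact h1
  | some v => exact h2 v (by rw [labels_toLabeled, Multiset.mem_range]; exact v.2)

theorem represents_unique {F G : LabeledForest} {l : List (Fin n)}
    (h : Represents A.children F l) (h' : Represents A.children G l) : F = G := by
  induction F generalizing l G with
  | nil =>
    cases G with
    | nil => rfl
    | cons =>
      obtain ⟨v, m, rfl, _⟩ := h'
      simp [Represents] at h
  | cons a k r hk hr =>
    obtain ⟨v, m, rfl, rfl, h1, h2⟩ := h
    cases G with
    | nil => simp [Represents] at h'
    | cons b k' r' =>
      obtain ⟨v', m', he, rfl, h1', h2'⟩ := h'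
      injection he with he1 he2
      subst he1 he2
      rw [hk h1 h1', hr h2 h2']

/-- The root list and the lists `kids u F` partition the labels, and the list containing a vertex
determines its father. -/
theorem exists_toLabeled_eq {F : LabeledForest} (hF : F.labels = Multiset.range n) :
    ∃ A : OrderedForest n, A.toLabeled = F := by
  have hnd : F.labels.Nodup := hF ▸ Multiset.nodup_range n
  have hlt : ∀ a, a ∈ F.labels ↔ a < n := fun a => by rw [hF, Multiset.mem_range]
  obtain ⟨t, ht⟩ := List.exists_map_val_eq (n := n) F.tops fun a ha =>
    (hlt a).1 (mem_labels_of_mem_tops ha)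
  have hk : ∀ u : Fin n, ∃ l : List (Fin n), l.map Fin.val = kids u F := fun u =>
    List.exists_map_val_eq _ fun a ha => (hlt a).1 (mem_labels_of_mem_kids ha).1
  choose c hc using hk
  have hmt : ∀ w : Fin n, w ∈ t ↔ (w : ℕ) ∈ F.tops := fun w => by
    rw [← ht, List.mem_map_of_injective Fin.val_injective]
  have hmc : ∀ u w : Fin n, w ∈ c u ↔ (w : ℕ) ∈ kids u F := fun u w => by
    rw [← hc, List.mem_map_of_injective Fin.val_injective]
  have hex : ∀ w : Fin n, ∃ i : Option (Fin n), w ∈ i.elim t c := by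
    intro w
    rcases mem_tops_or_kids ((hlt w).2 w.2) hnd with h | ⟨u, hu⟩
    · exact ⟨none, (hmt w).2 h⟩
    · exact ⟨some ⟨u, (hlt u).1 (mem_labels_of_mem_kids hu).2⟩, (hmc _ w).2 hu⟩
  choose p hp using hex
  have huniq : ∀ (w : Fin n) (i j : Option (Fin n)), w ∈ i.elim t c → w ∈ j.elim t c → i = j := by
    rintro w (_ | i) (_ | j) hi hj
    · rfl
    · exact absurd ((hmc j w).1 hj) (notMem_kids_of_mem_tops hnd ((hmt w).1 hi))
    · exact absurd ((hmc i w).1 hi) (notMem_kids_of_mem_tops hnd ((hmt w).1 hj))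
    · exact congrArg some (Fin.ext (kids_unique hnd ((hmc i w).1 hi) ((hmc j w).1 hj)))
  have hpi : ∀ i w, w ∈ i.elim t c ↔ p w = i :=
    fun i w => ⟨fun h => huniq w _ _ (hp w) h, fun h => h ▸ hp w⟩
  let A : OrderedForest n :=
    { parent := p
      children := fun i => i.elim t c
      acyclic := by
        intro v hv
        have hd : ∀ u w : Fin n, TransGen (Father p) u w → depth u 0 F < depth w 0 F := by
          intro u w h
          have hstep : ∀ u w : Fin n, Father p u w → depth u 0 F < depth w 0 F := by
            intro u w h
            rw [depth_of_mem_kids hnd ((hmc u w).1 ((hpi (some u) w).2 h))]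
            exact Nat.lt_succ_self _
          induction h with
          | single h => exact hstep _ _ h
          | tail _ h ih => exact ih.trans (hstep _ _ h)
        exact lt_irrefl _ (hd v v hv)
      nodup := by
        rintro (_ | i)
        · exact List.Nodup.of_map Fin.val (by
            simp only [Option.elim]; rw [ht]; exact nodup_tops hnd)
        · exact List.Nodup.of_map Fin.val (by
            simp only [Option.elim]; rw [hc]; exact nodup_kids hnd _)
      mem_children := hpi }
  refine ⟨A, represents_unique A.represents_toLabeled ?_⟩
  exact represents_of_kids hnd _ ht fun v _ => hc v

theorem toLabeled_mem_all (F : LabeledForest) :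
    F ∈ all n ↔ ∃ A : OrderedForest n, A.toLabeled = F := by
  rw [mem_all]
  exact ⟨exists_toLabeled_eq, fun ⟨A, hA⟩ => hA ▸ labels_toLabeled⟩

instance : Finite (OrderedForest n) := by
  have : Finite {F // F ∈ all n} := (all n).finite_toSet
  refine Finite.of_injective (β := {F // F ∈ all n})
    (fun A => ⟨A.toLabeled, (toLabeled_mem_all _).2 ⟨A, rfl⟩⟩) fun A B h => ?_
  exact toLabeled_injective (congrArg Subtype.val h)

theorem minLabel_eq_least {k : LabeledForest} {v : Fin n}
    (h : Represents A.children k (A.children (some v))) :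
    min ((v : ℕ) : WithTop ℕ) k.minLabel = (A.least v : WithTop ℕ) := by
  have h' : Represents A.children (cons v k nil) [v] := ⟨v, [], rfl, rfl, h, rfl⟩
  have h2 : (cons v k nil).minLabel = min ((v : ℕ) : WithTop ℕ) k.minLabel := by
    simp [minLabel]
  have h3 := mem_labels_iff h'
  simp only [List.mem_singleton, exists_eq_left] at h3
  rw [← h2]
  refine le_antisymm (minLabel_le _ _ ((h3 _).2 (leastDesc_spec v))) ?_
  by_cases ht : (cons v k nil).minLabel = ⊤
  · rw [ht]; exact le_top
  · obtain ⟨m, hm⟩ := WithTop.ne_top_iff_exists.1 ht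
    obtain ⟨j, hj, rfl⟩ := (h3 m).1 (minLabel_mem _ m hm.symm)
    rw [← hm]
    exact WithTop.coe_le_coe.2 (leastDesc_le hj)

theorem minLabel_le_iff {r : LabeledForest} {l : List (Fin n)} (h : Represents A.children r l)
    (m : ℕ) : r.minLabel ≤ (m : WithTop ℕ) ↔ ∃ k ∈ l, A.least k ≤ m := by
  constructor
  · intro hm
    obtain ⟨a, ha⟩ := WithTop.ne_top_iff_exists.1 (ne_of_lt (hm.trans_lt (WithTop.coe_lt_top m)))
    obtain ⟨k, hk, j, hj, rfl⟩ := (mem_labels_iff h a).1 (minLabel_mem _ a ha.symm)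
    refine ⟨k, hk, (leastDesc_le hj).trans ?_⟩
    rw [← ha] at hm
    exact WithTop.coe_le_coe.1 hm
  · rintro ⟨k, hk, hkm⟩
    exact (minLabel_le _ _ ((mem_labels_iff h _).2 ⟨k, hk, leastDesc_spec k⟩)).trans
      (WithTop.coe_le_coe.2 hkm)

/-- Brothers never share their smallest descendant, so `<` may be weakened to `≤`, the form used in
`vertexWeight`. -/
theorem elder_iff {i : Option (Fin n)} {l₀ l : List (Fin n)} {v : Fin n}
    (hl : A.children i = l₀ ++ v :: l) : A.Elder v ↔ ∃ k ∈ l, A.least k ≤ A.least v := by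
  have hv : A.parent v = i := by rw [← A.mem_children, hl]; simp
  have hnd := A.nodup i
  rw [hl] at hnd
  unfold Elder
  rw [hv, hl]
  refine exists_congr fun k => ?_
  rw [List.pair_sublist_iff_mem hnd]
  refine and_congr_right fun hk => ⟨le_of_lt, fun hle => lt_of_le_of_ne hle fun he => ?_⟩
  have hk' : A.parent k = i := by rw [← A.mem_children, hl]; simp [hk]
  have := leastDesc_inj A.acyclic (hk'.trans hv.symm) he
  subst this
  exact (List.nodup_cons.1 (List.nodup_append.1 hnd).2.1).1 hk

open Classical in
/-- The contribution of a vertex to the weight. -/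
noncomputable def vweight (A : OrderedForest n) (w : Fin n) : MvPolynomial (Fin 3) ℤ :=
  if A.Elder w then X 2 else
    match A.parent w with
    | none => X 0
    | some i => if A.least w < i then X 1 else 1

/-- The recursive weight is a product of local weights, as only minima over subtrees and over right
brothers enter. The default 1 is never taken: all labels come from `Fin n`. -/
theorem weight_eq_prod {F : LabeledForest} {l₀ l : List (Fin n)} {i : Option (Fin n)}
    (hl : A.children i = l₀ ++ l) (h : Represents A.children F l) :
    weight (i.map Fin.val) F
      = (F.labels.map fun a => if h : a < n then A.vweight ⟨a, h⟩ else 1).prod := by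
  induction F generalizing l₀ l i with
  | nil => simp [weight, labels]
  | cons b k r hk hr =>
    obtain ⟨v, l', rfl, rfl, h1, h2⟩ := h
    have hl' : A.children i = (l₀ ++ [v]) ++ l' := by simp [hl]
    have hv : A.parent v = i := by rw [← A.mem_children, hl]; simp
    have h3 := hk (l₀ := []) rfl h1
    have h4 := hr hl' h2
    rw [Option.map_some] at h3
    rw [weight, h3, h4, labels, Multiset.map_cons, Multiset.prod_cons, Multiset.map_add,
      Multiset.prod_add, mul_assoc, minLabel_eq_least h1, dif_pos v.2]
    congr 1
    unfold vertexWeight vweight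
    have h5 := elder_iff hl
    rw [← minLabel_le_iff h2] at h5
    by_cases he : r.minLabel ≤ (A.least v : WithTop ℕ)
    · simp only [he, h5.2 he, if_true]
    · simp only [he, mt h5.1 he, if_false, hv]
      cases i with
      | none => rfl
      | some i => simp

theorem weight_toLabeled : weight none A.toLabeled =
    X 0 ^ {w | ¬ A.Elder w ∧ A.parent w = none}.ncard *
    X 1 ^ {w | ¬ A.Elder w ∧ ∃ i, A.parent w = some i ∧ A.least w < i}.ncard *
    X 2 ^ {w | A.Elder w}.ncard := by
  classical
  have h1 := weight_eq_prod (i := none) (l₀ := []) rfl A.represents_toLabeled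
  rw [Option.map_none] at h1
  rw [h1, labels_toLabeled]
  change (∏ a ∈ Finset.range n, _) = _
  rw [Finset.prod_range]
  simp only [Fin.is_lt, Fin.eta, dif_pos]
  have hpow : ∀ (i : Fin 3) (P : Fin n → Prop), (X i : MvPolynomial (Fin 3) ℤ) ^ {w | P w}.ncard
      = ∏ w : Fin n, X i ^ (if P w then 1 else 0) := by
    intro i P
    have : {w | P w} = (Finset.univ.filter P : Set (Fin n)) := by ext; simp
    rw [Finset.prod_pow_eq_pow_sum, Finset.sum_boole, this, Set.ncard_coe_finset, Nat.cast_id]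
  rw [hpow, hpow, hpow, ← Finset.prod_mul_distrib, ← Finset.prod_mul_distrib]
  refine Finset.prod_congr rfl fun w _ => ?_
  unfold vweight
  by_cases he : A.Elder w
  · simp [he]
  · cases hp : A.parent w with
    | none => simp [he]
    | some i =>
      by_cases hlt : A.least w < i <;> simp [he, hlt]

end OrderedForest

/-! ### Cutting a list behind its right-to-left minima -/

section Blocks

variable {α : Type*} {key : α → ℕ}

/-- `bs` cuts a list behind its right-to-left minima: each block ends with its smallest element,
which is also smaller than everything in the later blocks. -/
def IsBlocks (key : α → ℕ) : List (List α) → Prop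
  | [] => True
  | b :: bs => (∃ b' m, b = b' ++ [m] ∧ (∀ x ∈ b', key m < key x) ∧
      ∀ x ∈ bs.flatten, key m < key x) ∧ IsBlocks key bs

theorem IsBlocks.exists_last {bs : List (List α)} (h : IsBlocks key bs) {b : List α} (hb : b ∈ bs) :
    ∃ b' m, b = b' ++ [m] ∧ ∀ x ∈ b', key m < key x := by
  induction bs with
  | nil => simp at hb
  | cons c bs ih =>
    rcases List.mem_cons.1 hb with rfl | hb
    · obtain ⟨⟨b', m, h1, h2, _⟩, _⟩ := h
      exact ⟨b', m, h1, h2⟩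
    · exact ih h.2 hb

/-- Built from the right: a new first element joins the first block if it exceeds the minimum of
that block, and otherwise is a block of its own. -/
theorem exists_isBlocks (l : List α) (hl : l.Nodup)
    (hinj : ∀ x ∈ l, ∀ y ∈ l, key x = key y → x = y) :
    ∃ bs, IsBlocks key bs ∧ bs.flatten = l := by
  induction l with
  | nil => exact ⟨[], trivial, rfl⟩
  | cons a l ih =>
    obtain ⟨ha, hl⟩ := List.nodup_cons.1 hl
    obtain ⟨bs, hbs, hfl⟩ := ih hl fun x hx y hy => hinj x (by simp [hx]) y (by simp [hy])
    cases bs with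
    | nil =>
      refine ⟨[[a]], ⟨⟨[], a, rfl, by simp, by simp⟩, trivial⟩, ?_⟩
      rw [← hfl]; rfl
    | cons b bs =>
      obtain ⟨⟨b', m, rfl, h1, h2⟩, h3⟩ := hbs
      have hm : m ∈ l := by rw [← hfl]; simp
      rcases lt_trichotomy (key m) (key a) with h | h | h
      · refine ⟨(a :: (b' ++ [m])) :: bs, ⟨⟨a :: b', m, rfl, ?_, h2⟩, h3⟩, by rw [← hfl]; simp⟩
        intro x hx
        rcases List.mem_cons.1 hx with rfl | hx
        · exact h
        · exact h1 x hx
      · exact absurd (hinj m (by simp [hm]) a (by simp) h ▸ hm) ha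
      · refine ⟨[a] :: (b' ++ [m]) :: bs, ⟨⟨[], a, rfl, by simp, ?_⟩, ⟨b', m, rfl, h1, h2⟩, h3⟩,
          by rw [← hfl]; simp⟩
        intro x hx
        simp only [List.flatten_cons, List.mem_append, List.mem_singleton] at hx
        rcases hx with (hx | rfl) | hx
        · exact h.trans (h1 x hx)
        · exact h
        · exact h.trans (h2 x hx)

/-- Both `m` and `m₂` are the unique element with smallest key in the same set. -/
theorem IsBlocks.last_eq {b b₂ : List α} {bs bs₂ : List (List α)} {m m₂ : α}
    (h1 : ∀ x ∈ b, key m < key x) (h2 : ∀ x ∈ bs.flatten, key m < key x)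
    (h1' : ∀ x ∈ b₂, key m₂ < key x) (h2' : ∀ x ∈ bs₂.flatten, key m₂ < key x)
    (h : ∀ x, x ∈ ((b ++ [m]) :: bs).flatten ↔ x ∈ ((b₂ ++ [m₂]) :: bs₂).flatten) : m = m₂ := by
  have ha : key m₂ < key m ∨ m = m₂ := by
    have := (h m).1 (by simp)
    simp only [List.flatten_cons, List.mem_append, List.mem_singleton] at this
    rcases this with (hx | hx) | hx
    · exact Or.inl (h1' _ hx)
    · exact Or.inr hx
    · exact Or.inl (h2' _ hx)
  have hb : key m < key m₂ ∨ m = m₂ := by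
    have := (h m₂).2 (by simp)
    simp only [List.flatten_cons, List.mem_append, List.mem_singleton] at this
    rcases this with (hx | hx) | hx
    · exact Or.inl (h1 _ hx)
    · exact Or.inr hx.symm
    · exact Or.inl (h2 _ hx)
  rcases ha with ha | ha
  · rcases hb with hb | hb
    · omega
    · exact hb
  · exact ha

/-- The first block must end at the overall minimum, which occurs only once in the list. -/
theorem IsBlocks.eq_of_flatten_eq {bs bs₂ : List (List α)} (h : IsBlocks key bs)
    (h' : IsBlocks key bs₂) (hnd : bs.flatten.Nodup) (he : bs.flatten = bs₂.flatten) :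
    bs = bs₂ := by
  induction bs generalizing bs₂ with
  | nil =>
    cases bs₂ with
    | nil => rfl
    | cons b₂ bs₂ =>
      obtain ⟨⟨b', m, rfl, _⟩, _⟩ := h'
      simp at he
  | cons b bs ih =>
    obtain ⟨⟨c, m, rfl, h1, h2⟩, h3⟩ := h
    cases bs₂ with
    | nil => simp at he
    | cons b₂ bs₂ =>
      obtain ⟨⟨c₂, m₂, rfl, h1', h2'⟩, h3'⟩ := h'
      obtain rfl := IsBlocks.last_eq h1 h2 h1' h2' fun x => by rw [he]
      simp only [List.flatten_cons, List.append_assoc, List.singleton_append] at he hnd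
      have hm : m ∉ c := fun hm => lt_irrefl _ (h1 m hm)
      have hm' : m ∉ c₂ := fun hm => lt_irrefl _ (h1' m hm)
      have hs : m ∉ bs.flatten := fun hm => lt_irrefl _ (h2 m hm)
      have hs' : m ∉ bs₂.flatten := fun hm => lt_irrefl _ (h2' m hm)
      have key1 : c = c₂ ∧ bs.flatten = bs₂.flatten := by
        rcases List.append_eq_append_iff.1 he with ⟨a, ha, hb⟩ | ⟨a, ha, hb⟩
        · cases a with
          | nil => simp_all
          | cons x a =>
            rw [List.cons_append, List.cons.injEq] at hb
            exact absurd (by rw [ha, ← hb.1]; simp) hm'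
        · cases a with
          | nil => simp_all
          | cons x a =>
            rw [List.cons_append, List.cons.injEq] at hb
            exact absurd (by rw [ha, ← hb.1]; simp) hm
      obtain ⟨rfl, hk⟩ := key1
      rw [ih h3 h3' (List.nodup_cons.1 (List.nodup_append.1 hnd).2.1).2 hk]

/-- After `m` is moved to the front, a rotation that keeps `m` there is trivial because `m` occurs
once. -/
theorem List.eq_of_isRotated_append_singleton {b c : List α} {m : α} (hnd : (b ++ [m]).Nodup)
    (h : (b ++ [m]) ~r (c ++ [m])) : b = c := by
  have h0 : ∀ d : List α, (m :: d) ~r (d ++ [m]) := fun d => ⟨1, by simp⟩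
  have h1 : (m :: b) ~r (m :: c) := (h0 b).trans (h.trans (h0 c).symm)
  have hnd' : (m :: b).Nodup := (h0 b).nodup_iff.2 hnd
  obtain ⟨k, hk⟩ := h1
  obtain ⟨j, hj, hjk⟩ : ∃ j, j < (m :: b).length ∧ (m :: b).rotate j = m :: c :=
    ⟨k % (m :: b).length, Nat.mod_lt _ (by simp), by rw [List.rotate_mod, hk]⟩
  have h2 : (m :: b)[j] = (m :: b)[0] := by
    have := List.getElem_rotate (m :: b) j 0 (by simp)
    simp only [hjk, List.getElem_cons_zero, zero_add, Nat.mod_eq_of_lt hj] at this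
    rw [← this]; rfl
  have h3 : j = 0 := (hnd'.getElem_inj_iff).1 h2
  subst h3
  rw [List.rotate_zero] at hjk
  exact (List.cons.inj hjk).2

/-- The first block is the cycle through the overall minimum `m`, cut open behind `m`. Remove it and
repeat. -/
theorem IsBlocks.eq_of_cycles_eq {bs bs₂ : List (List α)} (h : IsBlocks key bs)
    (h' : IsBlocks key bs₂) (hnd : bs.flatten.Nodup) (hnd' : bs₂.flatten.Nodup)
    (he : ∀ c : Cycle α, (∃ b ∈ bs, (b : Cycle α) = c) ↔ ∃ b ∈ bs₂, (b : Cycle α) = c) :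
    bs = bs₂ := by
  induction bs generalizing bs₂ with
  | nil =>
    cases bs₂ with
    | nil => rfl
    | cons b₂ bs₂ => simpa using (he b₂).2 ⟨b₂, by simp, rfl⟩
  | cons b bs ih =>
    cases bs₂ with
    | nil => simpa using (he b).1 ⟨b, by simp, rfl⟩
    | cons b₂ bs₂ =>
      have hmem : ∀ x, x ∈ (b :: bs).flatten ↔ x ∈ (b₂ :: bs₂).flatten := by
        intro x
        simp only [List.mem_flatten]
        constructor
        · rintro ⟨l, hl, hx⟩
          obtain ⟨l', hl', h1⟩ := (he l).1 ⟨l, hl, rfl⟩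
          exact ⟨l', hl', Cycle.mem_coe_iff.1 (h1 ▸ Cycle.mem_coe_iff.2 hx)⟩
        · rintro ⟨l, hl, hx⟩
          obtain ⟨l', hl', h1⟩ := (he l).2 ⟨l, hl, rfl⟩
          exact ⟨l', hl', Cycle.mem_coe_iff.1 (h1 ▸ Cycle.mem_coe_iff.2 hx)⟩
      obtain ⟨⟨c, m, rfl, h1, h2⟩, h3⟩ := h
      obtain ⟨⟨c₂, m₂, rfl, h1', h2'⟩, h3'⟩ := h'
      obtain rfl := IsBlocks.last_eq h1 h2 h1' h2' hmem
      have hs : ∀ l ∈ bs, m ∉ l := fun l hl hm =>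
        lt_irrefl _ (h2 m (List.mem_flatten.2 ⟨l, hl, hm⟩))
      have hs' : ∀ l ∈ bs₂, m ∉ l := fun l hl hm =>
        lt_irrefl _ (h2' m (List.mem_flatten.2 ⟨l, hl, hm⟩))
      have hc : c = c₂ := by
        obtain ⟨l, hl, hl'⟩ := (he (c ++ [m] : List α)).1 ⟨_, by simp, rfl⟩
        have hm : m ∈ l := by
          rw [← Cycle.mem_coe_iff, hl', Cycle.mem_coe_iff]; simp
        rcases List.mem_cons.1 hl with rfl | hl
        · rw [List.flatten_cons] at hnd
          exact List.eq_of_isRotated_append_singleton (List.nodup_append.1 hnd).1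
            (Cycle.coe_eq_coe.1 hl').symm
        · exact absurd hm (hs' l hl)
      subst hc
      rw [List.flatten_cons] at hnd hnd'
      rw [ih h3 h3' (List.nodup_append.1 hnd).2.1 (List.nodup_append.1 hnd').2.1 fun d => ?_]
      -- The cycles of the remaining blocks are those that avoid `m`, so the hypothesis passes to
      -- the tails.
      have hsplit : ∀ (L : List (List α)), (∀ l ∈ L, m ∉ l) → ((∃ b ∈ L, (b : Cycle α) = d) ↔
          (∃ b ∈ (c ++ [m]) :: L, (b : Cycle α) = d) ∧ m ∉ d) := by
        intro L hL
        constructor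
        · rintro ⟨l, hl, rfl⟩
          exact ⟨⟨l, by simp [hl], rfl⟩, fun hm => hL l hl (Cycle.mem_coe_iff.1 hm)⟩
        · rintro ⟨⟨l, hl, rfl⟩, hm⟩
          rcases List.mem_cons.1 hl with rfl | hl
          · exact absurd (Cycle.mem_coe_iff.2 (by simp)) hm
          · exact ⟨l, hl, rfl⟩
      rw [hsplit bs hs, hsplit bs₂ hs', he]

theorem Cycle.exists_eq_append_singleton {c : Cycle α} {m : α} (hm : m ∈ c) :
    ∃ b : List α, ((b ++ [m] : List α) : Cycle α) = c := by
  induction c using Cycle.induction_on with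
  | nil => exact absurd hm (Cycle.notMem_nil m)
  | cons a l _ =>
    obtain ⟨s, t, hst⟩ := List.append_of_mem (Cycle.mem_coe_iff.1 hm)
    refine ⟨t ++ s, ?_⟩
    rw [hst, Cycle.coe_eq_coe]
    refine ⟨t.length, ?_⟩
    rw [List.append_assoc, List.rotate_append_length_eq]
    simp

/-- Cut every cycle open behind its element of smallest key and sort the cycles by these minima. -/
theorem exists_isBlocks_of_cycles (S : Finset (Cycle α)) (hne : ∀ c ∈ S, ∃ x, x ∈ c)
    (hnd : ∀ c ∈ S, c.Nodup) (hdisj : ∀ c ∈ S, ∀ d ∈ S, ∀ x, x ∈ c → x ∈ d → c = d)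
    (hinj : ∀ c ∈ S, ∀ d ∈ S, ∀ x ∈ c, ∀ y ∈ d, key x = key y → x = y) :
    ∃ bs, IsBlocks key bs ∧ bs.flatten.Nodup ∧ ∀ c, c ∈ S ↔ ∃ b ∈ bs, (b : Cycle α) = c := by
  classical
  have hmin : ∀ c ∈ S, ∃ m ∈ c, key m = sInf {a | ∃ x ∈ c, key x = a} := by
    intro c hc
    obtain ⟨x, hx⟩ := hne c hc
    exact Nat.sInf_mem (s := {a | ∃ x ∈ c, key x = a}) ⟨_, x, hx, rfl⟩
  have hle : ∀ (c : Cycle α) (x : α), x ∈ c → sInf {a | ∃ x ∈ c, key x = a} ≤ key x :=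
    fun c x hx => Nat.sInf_le ⟨x, hx, rfl⟩
  induction S using Finset.induction_on_min_value
      (fun c : Cycle α => sInf {a | ∃ x ∈ c, key x = a}) with
  | empty => exact ⟨[], trivial, by simp, by simp⟩
  | insert c S hc hcS ih =>
    have hsub : ∀ d ∈ S, d ∈ insert c S := fun d => Finset.mem_insert_of_mem
    have hcc : c ∈ insert c S := Finset.mem_insert_self _ _
    obtain ⟨bs, h1, h2, h3⟩ := ih (fun d hd => hne d (hsub d hd)) (fun d hd => hnd d (hsub d hd))
      (fun d hd e he => hdisj d (hsub d hd) e (hsub e he))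
      (fun d hd e he => hinj d (hsub d hd) e (hsub e he)) (fun d hd => hmin d (hsub d hd))
    obtain ⟨m, hm, hm'⟩ := hmin c hcc
    obtain ⟨b, rfl⟩ := Cycle.exists_eq_append_singleton hm
    have hndb := Cycle.nodup_coe_iff.1 (hnd _ hcc)
    have hmb : m ∉ b := fun h => (List.nodup_append.1 hndb).2.2 m h m (by simp) rfl
    have hfl : ∀ x, x ∈ bs.flatten → ∃ d ∈ S, x ∈ d := by
      intro x hx
      obtain ⟨l, hl, hxl⟩ := List.mem_flatten.1 hx
      exact ⟨l, (h3 _).2 ⟨l, hl, rfl⟩, Cycle.mem_coe_iff.2 hxl⟩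
    refine ⟨(b ++ [m]) :: bs, ⟨⟨b, m, rfl, ?_, ?_⟩, h1⟩, ?_, ?_⟩
    · intro x hx
      have hxc : x ∈ ((b ++ [m] : List α) : Cycle α) := Cycle.mem_coe_iff.2 (by simp [hx])
      refine lt_of_le_of_ne (hm' ▸ hle _ x hxc) fun he => ?_
      exact hmb (hinj _ hcc _ hcc m hm x hxc he ▸ hx)
    · intro x hx
      obtain ⟨d, hd, hxd⟩ := hfl x hx
      refine lt_of_le_of_ne (hm' ▸ (hcS d hd).trans (hle d x hxd)) fun he => ?_
      have := hinj _ hcc d (hsub d hd) m hm x hxd he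
      subst this
      exact hc (hdisj _ hcc d (hsub d hd) m hm hxd ▸ hd)
    · rw [List.flatten_cons, List.nodup_append]
      refine ⟨hndb, h2, ?_⟩
      rintro x hx _ hy rfl
      obtain ⟨d, hd, hxd⟩ := hfl x hy
      exact hc (hdisj _ hcc d (hsub d hd) x (Cycle.mem_coe_iff.2 hx) hxd ▸ hd)
    · intro d
      rw [Finset.mem_insert, h3]
      simp [eq_comm]

/-- If the smaller element on the right lies in a later block, the last element of the block of `w`
is smaller still. So being elder can be tested inside a block, where order no longer matters. -/
theorem IsBlocks.exists_smaller_iff {bs : List (List α)} (h : IsBlocks key bs) (w : α) :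
    (∃ k, [w, k].Sublist bs.flatten ∧ key k < key w) ↔
      ∃ b ∈ bs, w ∈ b ∧ ∃ v ∈ b, key v < key w := by
  constructor
  · rintro ⟨k, hs, hk⟩
    induction bs with
    | nil => simp at hs
    | cons b bs ih =>
      obtain ⟨⟨b', m, hb, h1, h2⟩, h3⟩ := h
      rw [List.flatten_cons] at hs
      obtain ⟨s, t, hst, hs1, hs2⟩ := List.sublist_append_iff.1 hs
      rcases s with _ | ⟨x, _ | ⟨y, s⟩⟩
      · rw [List.nil_append] at hst
        obtain ⟨d, hd, hd'⟩ := ih h3 (hst ▸ hs2)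
        exact ⟨d, by simp [hd], hd'⟩
      · simp only [List.cons_append, List.nil_append, List.cons.injEq] at hst
        obtain ⟨rfl, rfl⟩ := hst
        have hk' : k ∈ bs.flatten := hs2.subset (by simp)
        exact ⟨b, by simp, hs1.subset (by simp), m, by simp [hb], (h2 k hk').trans hk⟩
      · simp only [List.cons_append, List.cons.injEq] at hst
        obtain ⟨rfl, rfl, _⟩ := hst
        exact ⟨b, by simp, hs1.subset (by simp), k, hs1.subset (by simp), hk⟩
  · rintro ⟨b, hb, hw, v, hv, hvw⟩
    obtain ⟨b', m, rfl, hm⟩ := h.exists_last hb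
    have hmv : key m ≤ key v := by
      rcases List.mem_append.1 hv with hv | hv
      · exact (hm v hv).le
      · rw [List.mem_singleton.1 hv]
    have hwb : w ∈ b' := by
      rcases List.mem_append.1 hw with hw | hw
      · exact hw
      · rw [List.mem_singleton.1 hw] at hvw; omega
    refine ⟨m, ?_, by omega⟩
    have : [w, m].Sublist (b' ++ [m]) :=
      (List.singleton_sublist.2 hwb).append (List.Sublist.refl [m])
    exact this.trans (List.sublist_flatten_of_mem hb)

end Blocks

theorem List.eq_of_mem_of_nodup_flatten {α : Type*} {L : List (List α)} (h : L.flatten.Nodup)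
    {b c : List α} (hb : b ∈ L) (hc : c ∈ L) {w : α} (hwb : w ∈ b) (hwc : w ∈ c) : b = c := by
  have : Std.Symm (List.Disjoint (α := α)) := ⟨fun _ _ h => h.symm⟩
  by_contra hne
  exact (List.nodup_flatten.1 h).2.forall hb hc hne hwb hwc

/-! ### The white skeleton of a half-mobile forest and its circles -/

namespace NamedHalfMobileForest

variable {n : ℕ} (F : NamedHalfMobileForest n)

/-- The nearest white proper ancestor of a white vertex. -/
def whiteParent (w : Fin n) : Option (Fin n) :=
  match F.parent (Sum.inl w) with
  | none => none
  | some (Sum.inl u) => some u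
  | some (Sum.inr x) =>
    match F.parent (Sum.inr x) with
    | some (Sum.inl u) => some u
    | _ => none

/-- The cyclically ordered sets of white vertices that hang together below `i`: white vertices
with no black father, and the children of black vertices. -/
def IsCircle (i : Option (Fin n)) (c : Cycle (Fin n)) : Prop :=
  (∃ w, F.parent (Sum.inl w) = i.map Sum.inl ∧ c = ([w] : List (Fin n))) ∨
    ∃ x, F.parent (Sum.inr x) = i.map Sum.inl ∧ c = F.cyc x

theorem exists_parent_inr (x : Fin F.numBlack) :
    ∃ i : Option (Fin n), F.parent (Sum.inr x) = i.map Sum.inl := by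
  rcases h : F.parent (Sum.inr x) with _ | u | y
  · exact ⟨none, rfl⟩
  · exact ⟨some u, rfl⟩
  · exact absurd h (F.black_children_white y x)

theorem whiteParent_of_white {w : Fin n} {i : Option (Fin n)}
    (h : F.parent (Sum.inl w) = i.map Sum.inl) : F.whiteParent w = i := by
  unfold whiteParent
  rw [h]
  cases i <;> rfl

theorem whiteParent_of_black {w : Fin n} {x : Fin F.numBlack} {i : Option (Fin n)}
    (h : F.parent (Sum.inl w) = some (Sum.inr x)) (hx : F.parent (Sum.inr x) = i.map Sum.inl) :
    F.whiteParent w = i := by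
  unfold whiteParent
  rw [h]
  simp only
  rw [hx]
  cases i <;> rfl

theorem parent_cases (w : Fin n) : F.parent (Sum.inl w) = (F.whiteParent w).map Sum.inl ∨
    ∃ x, F.parent (Sum.inl w) = some (Sum.inr x) ∧
      F.parent (Sum.inr x) = (F.whiteParent w).map Sum.inl := by
  rcases h : F.parent (Sum.inl w) with _ | u | x
  · left
    rw [F.whiteParent_of_white (i := none) h]; rfl
  · left
    rw [F.whiteParent_of_white (i := some u) h]; rfl
  · right
    obtain ⟨i, hi⟩ := F.exists_parent_inr x
    exact ⟨x, rfl, by rw [F.whiteParent_of_black h hi, hi]⟩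

theorem transGen_of_father {u w : Fin n} (h : Father F.whiteParent u w) :
    TransGen F.IsChild (Sum.inl u) (Sum.inl w) := by
  have h' : F.whiteParent w = some u := h
  rcases F.parent_cases w with h1 | ⟨x, h1, h2⟩
  · rw [h'] at h1
    exact .single h1
  · rw [h'] at h2
    exact .tail (.single h2) h1

theorem whiteParent_acyclic (v : Fin n) : ¬ TransGen (Father F.whiteParent) v v := by
  have : ∀ u w, TransGen (Father F.whiteParent) u w →
      TransGen F.IsChild (Sum.inl u) (Sum.inl w) := by
    intro u w h
    induction h with
    | single h => exact F.transGen_of_father h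
    | tail _ h ih => exact ih.trans (F.transGen_of_father h)
  exact fun h => F.acyclic _ (this v v h)

/-- Black vertices are only intermediate steps. The induction along a path also carries a claim for
black endpoints: their white father already descends from `u`. -/
theorem desc_iff (u w : Fin n) :
    F.Desc (Sum.inl u) (Sum.inl w) ↔ ReflTransGen (Father F.whiteParent) u w := by
  constructor
  · intro h
    have key : ∀ v, F.Desc (Sum.inl u) v →
        (∀ w, v = Sum.inl w → ReflTransGen (Father F.whiteParent) u w) ∧
        (∀ x, v = Sum.inr x → ∃ a, F.parent (Sum.inr x) = some (Sum.inl a) ∧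
          ReflTransGen (Father F.whiteParent) u a) := by
      intro v hv
      induction hv with
      | refl =>
        refine ⟨?_, ?_⟩
        · rintro w ⟨⟩; exact .refl
        · rintro x ⟨⟩
      | tail _ hbc ih =>
        rename_i b c _
        have hbc : F.parent c = some b := hbc
        refine ⟨?_, ?_⟩
        · rintro w rfl
          rcases b with a | x
          · exact (ih.1 a rfl).tail (F.whiteParent_of_white (i := some a) hbc)
          · obtain ⟨a, ha, hua⟩ := ih.2 x rfl
            exact hua.tail (F.whiteParent_of_black (i := some a) hbc ha)
        · rintro x rfl
          rcases b with a | y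
          · exact ⟨a, hbc, ih.1 a rfl⟩
          · exact absurd hbc (F.black_children_white y x)
    exact (key _ h).1 w rfl
  · intro h
    induction h with
    | refl => exact .refl
    | tail _ h ih => exact ih.trans (F.transGen_of_father h).to_reflTransGen

theorem beta_inl (u : Fin n) : F.beta (Sum.inl u) = leastDesc F.whiteParent u := by
  unfold beta leastDesc
  simp only [desc_iff]

theorem ncard_children (x : Fin F.numBlack) :
    {w | F.parent w = some (Sum.inr x)}.ncard =
      {w | F.parent (Sum.inl w) = some (Sum.inr x)}.ncard := by
  symm
  refine Set.ncard_congr (fun w _ => Sum.inl w) (fun w hw => hw)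
    (fun a b _ _ h => Sum.inl_injective h) ?_
  rintro (w | y) hw
  · exact ⟨w, hw, rfl⟩
  · exact absurd hw (F.black_children_white x y)

theorem two_le_length {x : Fin F.numBlack} {l : List (Fin n)} (h : F.cyc x = l) :
    2 ≤ l.length := by
  classical
  have h2 := F.two_le_children x
  rw [ncard_children] at h2
  have : {w | F.parent (Sum.inl w) = some (Sum.inr x)} = (l.toFinset : Set (Fin n)) := by
    ext w
    have := F.mem_cyc x w
    rw [h, Cycle.mem_coe_iff] at this
    simp [this]
  rw [this, Set.ncard_coe_finset] at h2
  exact h2.trans (List.toFinset_card_le l)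

theorem cyc_ne_singleton (x : Fin F.numBlack) (w : Fin n) : F.cyc x ≠ ([w] : List (Fin n)) :=
  fun h => by simpa using F.two_le_length h

theorem exists_mem_cyc (x : Fin F.numBlack) : ∃ w, w ∈ F.cyc x := by
  obtain ⟨l, hl⟩ : ∃ l : List (Fin n), F.cyc x = l := ⟨_, (Quot.out_eq (F.cyc x)).symm⟩
  have := F.two_le_length hl
  cases l with
  | nil => simp at this
  | cons a l => exact ⟨a, by rw [hl, Cycle.mem_coe_iff]; simp⟩

variable {F}

theorem IsCircle.nodup {i : Option (Fin n)} {c : Cycle (Fin n)} (h : F.IsCircle i c) :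
    c.Nodup := by
  rcases h with ⟨w, _, rfl⟩ | ⟨x, _, rfl⟩
  · simp
  · exact F.cyc_nodup x

theorem IsCircle.exists_mem {i : Option (Fin n)} {c : Cycle (Fin n)} (h : F.IsCircle i c) :
    ∃ w, w ∈ c := by
  rcases h with ⟨w, _, rfl⟩ | ⟨x, _, rfl⟩
  · exact ⟨w, by simp⟩
  · exact F.exists_mem_cyc x

theorem IsCircle.whiteParent_eq {i : Option (Fin n)} {c : Cycle (Fin n)} (h : F.IsCircle i c)
    {w : Fin n} (hw : w ∈ c) : F.whiteParent w = i := by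
  rcases h with ⟨v, hv, rfl⟩ | ⟨x, hx, rfl⟩
  · rw [Cycle.mem_coe_iff, List.mem_singleton] at hw
    subst hw
    exact F.whiteParent_of_white hv
  · exact F.whiteParent_of_black ((F.mem_cyc x w).1 hw) hx

theorem IsCircle.eq {i j : Option (Fin n)} {c d : Cycle (Fin n)} (h : F.IsCircle i c)
    (h' : F.IsCircle j d) {w : Fin n} (hw : w ∈ c) (hw' : w ∈ d) : c = d := by
  rcases h with ⟨v, hv, rfl⟩ | ⟨x, hx, rfl⟩ <;> rcases h' with ⟨v', hv', rfl⟩ | ⟨x', hx', rfl⟩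
  · rw [Cycle.mem_coe_iff, List.mem_singleton] at hw hw'
    rw [← hw, ← hw']
  · rw [Cycle.mem_coe_iff, List.mem_singleton] at hw
    subst hw
    rw [(F.mem_cyc _ _).1 hw'] at hv
    cases i <;> simp at hv
  · rw [Cycle.mem_coe_iff, List.mem_singleton] at hw'
    subst hw'
    rw [(F.mem_cyc _ _).1 hw] at hv'
    cases j <;> simp at hv'
  · have h1 := (F.mem_cyc _ _).1 hw
    rw [(F.mem_cyc _ _).1 hw'] at h1
    simp only [Option.some.injEq, Sum.inr.injEq] at h1
    rw [h1]

theorem isCircle_cyc {w : Fin n} {x : Fin F.numBlack}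
    (h : F.parent (Sum.inl w) = some (Sum.inr x)) : F.IsCircle (F.whiteParent w) (F.cyc x) := by
  obtain ⟨i, hi⟩ := F.exists_parent_inr x
  rw [F.whiteParent_of_black h hi]
  exact Or.inr ⟨x, hi, rfl⟩

theorem exists_isCircle (w : Fin n) : ∃ c, F.IsCircle (F.whiteParent w) c ∧ w ∈ c := by
  rcases F.parent_cases w with h | ⟨x, h1, h2⟩
  · exact ⟨_, Or.inl ⟨w, h, rfl⟩, by simp⟩
  · exact ⟨_, isCircle_cyc h1, (F.mem_cyc x w).2 h1⟩

theorem finite_isCircle (i : Option (Fin n)) : {c | F.IsCircle i c}.Finite := by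
  refine ((Set.finite_range fun w : Fin n => (([w] : List (Fin n)) : Cycle (Fin n))).union
    (Set.finite_range F.cyc)).subset ?_
  rintro c (⟨w, _, rfl⟩ | ⟨x, _, rfl⟩)
  · exact Or.inl ⟨w, rfl⟩
  · exact Or.inr ⟨x, rfl⟩

/-- A named forest is determined up to isomorphism by its circles. -/
theorem equiv_of_isCircle_iff {G : NamedHalfMobileForest n}
    (h : ∀ i c, F.IsCircle i c ↔ G.IsCircle i c) :
    ∃ e : Fin F.numBlack ≃ Fin G.numBlack, IsIso F G e := by
  -- The cycle of a black vertex has length at least two, so a singleton circle cannot account for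
  -- it and it must come from a black vertex of `G`.
  have key : ∀ {F G : NamedHalfMobileForest n}, (∀ i c, F.IsCircle i c ↔ G.IsCircle i c) →
      ∀ (x : Fin F.numBlack) (i : Option (Fin n)), F.parent (Sum.inr x) = i.map Sum.inl →
        ∃ y, G.parent (Sum.inr y) = i.map Sum.inl ∧ G.cyc y = F.cyc x := by
    intro F G h x i hi
    rcases (h i _).1 (Or.inr ⟨x, hi, rfl⟩) with ⟨w, _, hw⟩ | ⟨y, hy, hc⟩
    · exact absurd hw (F.cyc_ne_singleton x w)
    · exact ⟨y, hy, hc.symm⟩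
  have hinj : ∀ {F : NamedHalfMobileForest n} {x y : Fin F.numBlack}, F.cyc x = F.cyc y →
      x = y := by
    intro F x y hxy
    obtain ⟨w, hw⟩ := F.exists_mem_cyc x
    have h1 := (F.mem_cyc _ _).1 hw
    rw [(F.mem_cyc _ _).1 (hxy ▸ hw)] at h1
    simp only [Option.some.injEq, Sum.inr.injEq] at h1
    exact h1.symm
  have hex : ∀ x : Fin F.numBlack, ∃ y, G.parent (Sum.inr y)
      = (F.exists_parent_inr x).choose.map Sum.inl ∧ G.cyc y = F.cyc x :=
    fun x => key h x _ (F.exists_parent_inr x).choose_spec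
  choose f hf hfc using hex
  have hbij : Function.Bijective f := by
    constructor
    · intro x y hxy
      exact hinj ((hfc x).symm.trans (hxy ▸ hfc y))
    · intro y
      obtain ⟨i, hi⟩ := G.exists_parent_inr y
      obtain ⟨x, _, hx⟩ := key (fun i c => (h i c).symm) y i hi
      exact ⟨x, hinj ((hfc x).trans hx)⟩
  refine ⟨Equiv.ofBijective f hbij, ?_, hfc⟩
  rintro (w | x)
  · change G.parent (Sum.inl w) = _
    rcases F.parent_cases w with h1 | ⟨x, h1, h2⟩
    · rcases (h _ _).1 (Or.inl ⟨w, h1, rfl⟩) with ⟨v, hv, hvw⟩ | ⟨y, hy, hc⟩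
      · have : w = v := by
          have : w ∈ (([v] : List (Fin n)) : Cycle (Fin n)) := by rw [← hvw]; simp
          simpa using this
        rw [this, hv, ← this, h1]
        cases F.whiteParent w <;> rfl
      · exact absurd hc.symm (G.cyc_ne_singleton y w)
    · rw [h1]
      refine (G.mem_cyc (f x) w).1 ?_
      rw [hfc, F.mem_cyc, h1]
  · change G.parent (Sum.inr (f x)) = _
    have hs := (F.exists_parent_inr x).choose_spec
    have hs' := hf x
    generalize (F.exists_parent_inr x).choose = i at hs hs'
    rw [hs, hs']
    cases i <;> rfl

end NamedHalfMobileForest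

/-! ### The bijection between ordered forests and half-mobile forests -/

open NamedHalfMobileForest in
/-- `A` and `F` have the same white tree structure, and the blocks of the children in `A` are the
circles of `F`. -/
def OrderedForest.Matches {n : ℕ} (A : OrderedForest n) (F : NamedHalfMobileForest n) : Prop :=
  A.parent = F.whiteParent ∧ ∀ i, ∃ bs, IsBlocks A.least bs ∧ bs.flatten = A.children i ∧
    ∀ c, F.IsCircle i c ↔ ∃ b ∈ bs, (b : Cycle (Fin n)) = c

namespace OrderedForest

variable {n : ℕ}

/-- The circles below a given vertex are nonempty and disjoint, and their members are siblings in
the white skeleton. Hence β separates them and the circles can be arranged into blocks. -/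
theorem exists_matches_of_named (F : NamedHalfMobileForest n) :
    ∃ A : OrderedForest n, A.Matches F := by
  have hex : ∀ i, ∃ bs, IsBlocks (leastDesc F.whiteParent) bs ∧ bs.flatten.Nodup ∧
      ∀ c, F.IsCircle i c ↔ ∃ b ∈ bs, (b : Cycle (Fin n)) = c := by
    intro i
    have hS : ∀ c, c ∈ (F.finite_isCircle i).toFinset ↔ F.IsCircle i c := fun c => by simp
    obtain ⟨bs, h1, h2, h3⟩ := exists_isBlocks_of_cycles (key := leastDesc F.whiteParent)
      (F.finite_isCircle i).toFinset (fun c hc => ((hS c).1 hc).exists_mem)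
      (fun c hc => ((hS c).1 hc).nodup)
      (fun c hc d hd x hx hx' => ((hS c).1 hc).eq ((hS d).1 hd) hx hx')
      (fun c hc d hd x hx y hy hxy => leastDesc_inj F.whiteParent_acyclic
        ((((hS c).1 hc).whiteParent_eq hx).trans (((hS d).1 hd).whiteParent_eq hy).symm) hxy)
    exact ⟨bs, h1, h2, fun c => (hS c).symm.trans (h3 c)⟩
  choose bs h1 h2 h3 using hex
  refine ⟨⟨F.whiteParent, fun i => (bs i).flatten, F.whiteParent_acyclic, h2, ?_⟩, rfl,
    fun i => ⟨bs i, h1 i, rfl, h3 i⟩⟩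
  intro i w
  rw [List.mem_flatten]
  constructor
  · rintro ⟨b, hb, hw⟩
    exact ((h3 i b).2 ⟨b, hb, rfl⟩).whiteParent_eq (Cycle.mem_coe_iff.2 hw)
  · rintro rfl
    obtain ⟨c, hc, hw⟩ := F.exists_isCircle w
    obtain ⟨b, hb, rfl⟩ := (h3 _ c).1 hc
    exact ⟨b, hb, Cycle.mem_coe_iff.1 hw⟩

/-- The common circles together with β determine the blocks, and thus the sibling lists. -/
theorem Matches.eq {A B : OrderedForest n} {F : NamedHalfMobileForest n} (hA : A.Matches F)
    (hB : B.Matches F) : A = B := by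
  refine ext_children (funext fun i => ?_)
  obtain ⟨bs, h1, h2, h3⟩ := hA.2 i
  obtain ⟨bs', h1', h2', h3'⟩ := hB.2 i
  have hl : A.least = B.least := by
    unfold OrderedForest.least; rw [hA.1, hB.1]
  rw [← hl] at h1'
  rw [← h2, ← h2', h1.eq_of_cycles_eq h1' (h2 ▸ A.nodup i) (h2' ▸ B.nodup i)
    fun c => (h3 c).symm.trans (h3' c)]

/-- The sibling lists determine the blocks, hence the circles, hence the forest up to the names of
black vertices. -/
theorem Matches.equiv {A : OrderedForest n} {F G : NamedHalfMobileForest n} (hF : A.Matches F)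
    (hG : A.Matches G) : ∃ e : Fin F.numBlack ≃ Fin G.numBlack, NamedHalfMobileForest.IsIso F G e := by
  refine NamedHalfMobileForest.equiv_of_isCircle_iff fun i c => ?_
  obtain ⟨bs, h1, h2, h3⟩ := hF.2 i
  obtain ⟨bs', h1', h2', h3'⟩ := hG.2 i
  have := h1.eq_of_flatten_eq h1' (h2 ▸ A.nodup i) (h2.trans h2'.symm)
  rw [h3, h3', this]

/-- One black vertex is created for every block of length at least two. The block itself serves as
its provisional name, since blocks are nonempty and disjoint. -/
theorem exists_named_of_ordered (A : OrderedForest n) :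
    ∃ F : NamedHalfMobileForest n, A.Matches F := by
  classical
  have hex : ∀ i, ∃ bs, IsBlocks A.least bs ∧ bs.flatten = A.children i := fun i =>
    exists_isBlocks _ (A.nodup i) fun x hx y hy h => leastDesc_inj A.acyclic
      (((A.mem_children _ _).1 hx).trans ((A.mem_children _ _).1 hy).symm) h
  choose bs hbs hfl using hex
  have hmem : ∀ i w, (∃ b ∈ bs i, w ∈ b) ↔ A.parent w = i := fun i w => by
    rw [← A.mem_children, ← hfl, List.mem_flatten]
  have hblk : ∀ w, ∃ b ∈ bs (A.parent w), w ∈ b := fun w => (hmem _ w).2 rfl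
  choose blk hblk hwblk using hblk
  have hnd : ∀ i, (bs i).flatten.Nodup := fun i => hfl i ▸ A.nodup i
  have huniq : ∀ i, ∀ b ∈ bs i, ∀ w, w ∈ b → blk w = b := by
    intro i b hb w hw
    have hi : A.parent w = i := (hmem i w).1 ⟨b, hb, hw⟩
    exact List.eq_of_mem_of_nodup_flatten (hnd i) (hi ▸ hblk w) hb (hwblk w) hw
  have hpar : ∀ v w, blk v = blk w → A.parent v = A.parent w := fun v w h =>
    (hmem _ v).1 ⟨blk w, hblk w, h ▸ hwblk v⟩
  let B := {b : List (Fin n) // ∃ w, blk w = b ∧ 2 ≤ b.length}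
  have : Finite B := (Set.finite_range blk).subset (by rintro b ⟨w, hw, _⟩; exact ⟨w, hw⟩)
  let e : B ≃ Fin (Nat.card B) := Finite.equivFin B
  have hrep : ∀ x, ∃ w, blk w = (e.symm x).1 := fun x => ⟨_, (e.symm x).2.choose_spec.1⟩
  have hlen : ∀ x, 2 ≤ (e.symm x).1.length := fun x => (e.symm x).2.choose_spec.2
  choose rep hrep using hrep
  have hmb : ∀ x w, w ∈ (e.symm x).1 ↔ blk w = (e.symm x).1 := by
    intro x w
    constructor
    · intro hw
      rw [← hrep x] at hw ⊢
      exact huniq _ _ (hblk _) w hw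
    · intro h
      exact h ▸ hwblk w
  have hndb : ∀ w, (blk w).Nodup := fun w => (List.nodup_flatten.1 (hnd _)).1 _ (hblk w)
  let P : Fin n ⊕ Fin (Nat.card B) → Option (Fin n ⊕ Fin (Nat.card B)) := Sum.elim
    (fun w => if h : 2 ≤ (blk w).length then some (Sum.inr (e ⟨blk w, w, rfl, h⟩))
      else (A.parent w).map Sum.inl)
    (fun x => (A.parent (rep x)).map Sum.inl)
  have hPr : ∀ x, P (Sum.inr x) = (A.parent (rep x)).map Sum.inl := fun x => rfl
  have hPb : ∀ w x, P (Sum.inl w) = some (Sum.inr x) ↔ blk w = (e.symm x).1 := by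
    intro w x
    simp only [P, Sum.elim_inl]
    split_ifs with h
    · simp only [Option.some.injEq, Sum.inr.injEq]
      rw [← Equiv.eq_symm_apply]
      exact Subtype.ext_iff
    · constructor
      · intro h'
        cases hp : A.parent w <;> simp [hp] at h'
      · intro h'
        exact absurd (h' ▸ hlen x) h
  have hPw : ∀ w, ¬ 2 ≤ (blk w).length → P (Sum.inl w) = (A.parent w).map Sum.inl :=
    fun w h => dif_neg h
  have hPl : ∀ w, 2 ≤ (blk w).length → ∃ x, P (Sum.inl w) = some (Sum.inr x) :=
    fun w h => ⟨_, dif_pos h⟩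
  have hPu : ∀ w u, P (Sum.inl w) = some (Sum.inl u) → A.parent w = some u := by
    intro w u h
    by_cases h2 : 2 ≤ (blk w).length
    · obtain ⟨x, hx⟩ := hPl w h2
      rw [hx] at h
      simp at h
    · rw [hPw w h2] at h
      cases hp : A.parent w with
      | none => simp [hp] at h
      | some v => simpa [hp] using h
  -- To push paths through black vertices, a path from a white vertex to `x` is read as a path to
  -- every member of the block of `x`.
  have hchain : ∀ u v, TransGen (fun u w => P w = some u) (Sum.inl u) v →
      (∀ w, v = Sum.inl w → TransGen (Father A.parent) u w) ∧
      (∀ x, v = Sum.inr x → ∀ w, blk w = (e.symm x).1 → TransGen (Father A.parent) u w) := by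
    have hup : ∀ u x w, P (Sum.inr x) = some (Sum.inl u) → blk w = (e.symm x).1 →
        Father A.parent u w := by
      intro u x w h hw
      rw [hPr, ← hpar w (rep x) (hw.trans (hrep x).symm)] at h
      change A.parent w = some u
      cases hp : A.parent w with
      | none => simp [hp] at h
      | some v => simpa [hp] using h
    intro u v h
    induction h with
    | single h =>
      refine ⟨?_, ?_⟩
      · rintro w rfl
        exact .single (hPu w u h)
      · rintro x rfl w hw
        exact .single (hup u x w h hw)
    | tail _ h ih =>
      rename_i b c _
      refine ⟨?_, ?_⟩
      · rintro w rfl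
        rcases b with a | x
        · exact (ih.1 a rfl).tail (hPu w a h)
        · exact ih.2 x rfl w ((hPb w x).1 h)
      · rintro x rfl w hw
        rcases b with a | y
        · exact (ih.1 a rfl).tail (hup a x w h hw)
        · rw [hPr] at h
          cases hp : A.parent (rep x) <;> simp [hp] at h
  let F : NamedHalfMobileForest n :=
    { numBlack := Nat.card B
      parent := P
      acyclic := by
        have hw : ∀ w, ¬ TransGen (fun u w => P w = some u) (Sum.inl w) (Sum.inl w) :=
          fun w h => A.acyclic w ((hchain w _ h).1 w rfl)
        rintro (w | x) h
        · exact hw w h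
        -- The child following a black vertex on a cycle is white, so the cycle can be started
        -- there.
        · rcases TransGen.head'_iff.1 h with ⟨c, hc, hc'⟩
          rcases c with w | y
          · exact hw w (TransGen.tail' hc' hc)
          · rw [hPr] at hc
            cases hp : A.parent (rep y) <;> simp [hp] at hc
      black_children_white := by
        intro x y h
        rw [hPr] at h
        cases hp : A.parent (rep y) <;> simp [hp] at h
      two_le_children := by
        intro x
        refine (hlen x).trans ?_
        have hn : (e.symm x).1.Nodup := hrep x ▸ hndb _
        rw [← List.toFinset_card_of_nodup hn, ← Set.ncard_coe_finset,
          ← Set.ncard_image_of_injective _ (Sum.inl_injective (β := Fin (Nat.card B)))]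
        refine Set.ncard_le_ncard ?_ (Set.toFinite _)
        rintro _ ⟨w, hw, rfl⟩
        refine (hPb w x).2 ((hmb x w).1 ?_)
        simpa using hw
      cyc := fun x => ((e.symm x).1 : List (Fin n))
      cyc_nodup := fun x => Cycle.nodup_coe_iff.2 (hrep x ▸ hndb _)
      mem_cyc := fun x w => by rw [Cycle.mem_coe_iff, hPb, hmb] }
  refine ⟨F, funext fun w => ?_, fun i => ⟨bs i, hbs i, hfl i, fun c => ?_⟩⟩
  · symm
    by_cases h2 : 2 ≤ (blk w).length
    · obtain ⟨x, hx⟩ := hPl w h2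
      refine F.whiteParent_of_black hx ?_
      rw [hpar w (rep x) (((hPb w x).1 hx).trans (hrep x).symm)]
      exact hPr x
    · exact F.whiteParent_of_white (hPw w h2)
  · constructor
    · rintro (⟨w, hw, rfl⟩ | ⟨x, hx, rfl⟩)
      · have h2 : ¬ 2 ≤ (blk w).length := by
          intro h2
          obtain ⟨x, hx⟩ := hPl w h2
          rw [show F.parent (Sum.inl w) = P (Sum.inl w) from rfl, hx] at hw
          cases i <;> simp at hw
        have hi : A.parent w = i := by
          have h3 := hPw w h2
          rw [show P (Sum.inl w) = F.parent (Sum.inl w) from rfl, hw] at h3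
          exact (Option.map_injective Sum.inl_injective h3).symm
        refine ⟨blk w, hi ▸ hblk w, ?_⟩
        have := hwblk w
        rcases hb : blk w with _ | ⟨a, _ | ⟨b, l⟩⟩
        · simp [hb] at this
        · rw [hb, List.mem_singleton] at this
          rw [this]
        · simp [hb] at h2
      · have hi : A.parent (rep x) = i := Option.map_injective Sum.inl_injective hx
        exact ⟨(e.symm x).1, hi ▸ hrep x ▸ hblk _, rfl⟩
    · rintro ⟨b, hb, rfl⟩
      obtain ⟨b', m, hbm, _⟩ := (hbs i).exists_last hb
      have hmm : m ∈ b := by simp [hbm]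
      have hi : A.parent m = i := (hmem i m).1 ⟨b, hb, hmm⟩
      have hbl : blk m = b := huniq i b hb m hmm
      by_cases h2 : 2 ≤ (blk m).length
      · obtain ⟨x, hx⟩ := hPl m h2
        have hx' := (hPb m x).1 hx
        refine Or.inr ⟨x, ?_, ?_⟩
        · rw [← hi, hpar m (rep x) (hx'.trans (hrep x).symm)]
          exact hPr x
        · rw [← hbl, hx']
      · refine Or.inl ⟨m, ?_, ?_⟩
        · rw [← hi]
          exact hPw m h2
        · have : b' = [] := by
            rw [hbl, hbm] at h2
            simpa using h2
          rw [hbm, this, List.nil_append]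

end OrderedForest

/-! ### Invariance of circles and transfer of the three statistics -/

namespace NamedHalfMobileForest.IsIso

variable {n : ℕ} {F G : NamedHalfMobileForest n} {e : Fin F.numBlack ≃ Fin G.numBlack}

theorem parent_eq_map (h : IsIso F G e) {v : F.Vertex} {i : Option (Fin n)}
    (hv : F.parent v = i.map Sum.inl) : G.parent (relabel e v) = i.map Sum.inl := by
  rw [h.1, hv]
  cases i <;> rfl

theorem isCircle (h : IsIso F G e) {i : Option (Fin n)} {c : Cycle (Fin n)}
    (hc : F.IsCircle i c) : G.IsCircle i c := by
  rcases hc with ⟨w, hw, rfl⟩ | ⟨x, hx, rfl⟩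
  · exact Or.inl ⟨w, h.parent_eq_map hw, rfl⟩
  · exact Or.inr ⟨e x, h.parent_eq_map hx, (h.2 x).symm⟩

theorem whiteParent_eq (h : IsIso F G e) : F.whiteParent = G.whiteParent := by
  funext w
  obtain ⟨c, hc, hw⟩ := F.exists_isCircle w
  exact ((h.isCircle hc).whiteParent_eq hw).symm

end NamedHalfMobileForest.IsIso

namespace OrderedForest

namespace Matches

variable {n : ℕ} {A : OrderedForest n} {F : NamedHalfMobileForest n} (h : A.Matches F)

include h

theorem beta_inl (w : Fin n) : F.beta (Sum.inl w) = A.least w := by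
  rw [F.beta_inl, ← h.1]

/-- The elder vertices are those that are not minimal in their circle, since the last element of a
block is its minimum. -/
theorem elder_iff (w : Fin n) : A.Elder w ↔
    ∃ i c, F.IsCircle i c ∧ w ∈ c ∧ ∃ v ∈ c, A.least v < A.least w := by
  have key : ∀ i, A.parent w = i → (A.Elder w ↔
      ∃ c, F.IsCircle i c ∧ w ∈ c ∧ ∃ v ∈ c, A.least v < A.least w) := by
    rintro i rfl
    obtain ⟨bs, h1, h2, h3⟩ := h.2 (A.parent w)
    unfold Elder
    rw [← h2, h1.exists_smaller_iff]
    constructor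
    · rintro ⟨b, hb, hw, v, hv, hvw⟩
      exact ⟨b, (h3 _).2 ⟨b, hb, rfl⟩, Cycle.mem_coe_iff.2 hw, v, Cycle.mem_coe_iff.2 hv, hvw⟩
    · rintro ⟨c, hc, hw, v, hv, hvw⟩
      obtain ⟨b, hb, rfl⟩ := (h3 c).1 hc
      exact ⟨b, hb, Cycle.mem_coe_iff.1 hw, v, Cycle.mem_coe_iff.1 hv, hvw⟩
  constructor
  · intro he
    exact ⟨_, (key _ rfl).1 he⟩
  · rintro ⟨i, c, hc, hw, hv⟩
    exact (key i (by rw [h.1]; exact hc.whiteParent_eq hw)).2 ⟨c, hc, hw, hv⟩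

theorem not_elder_of_white {w : Fin n} {i : Option (Fin n)}
    (hw : F.parent (Sum.inl w) = i.map Sum.inl) : ¬ A.Elder w := by
  rw [h.elder_iff]
  rintro ⟨j, c, hc, hwc, v, hv, hvw⟩
  have := hc.eq (Or.inl ⟨w, hw, rfl⟩) hwc (by simp)
  subst this
  rw [Cycle.mem_coe_iff, List.mem_singleton] at hv
  subst hv
  exact lt_irrefl _ hvw

theorem elder_iff_of_black {w : Fin n} {x : Fin F.numBlack}
    (hw : F.parent (Sum.inl w) = some (Sum.inr x)) :
    A.Elder w ↔ ∃ v, F.parent (Sum.inl v) = some (Sum.inr x) ∧ A.least v < A.least w := by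
  have hwx := (F.mem_cyc x w).2 hw
  have hcx := NamedHalfMobileForest.isCircle_cyc hw
  rw [h.elder_iff]
  constructor
  · rintro ⟨j, c, hc, hwc, v, hv, hvw⟩
    have := hc.eq hcx hwc hwx
    subst this
    exact ⟨v, (F.mem_cyc x v).1 hv, hvw⟩
  · rintro ⟨v, hv, hvw⟩
    exact ⟨_, _, hcx, hwx, v, (F.mem_cyc x v).2 hv, hvw⟩

theorem isRightmost_iff (w : Fin n) (x : Fin F.numBlack) :
    F.IsRightmost x (Sum.inl w) ↔ F.parent (Sum.inl w) = some (Sum.inr x) ∧ ¬ A.Elder w := by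
  refine and_congr_right fun hw => ?_
  rw [h.elder_iff_of_black hw]
  push Not
  constructor
  · intro hv v hvx
    have := hv (Sum.inl v) hvx
    rwa [h.beta_inl, h.beta_inl] at this
  · rintro hv (v | y) hvx
    · rw [h.beta_inl, h.beta_inl]
      exact hv v hvx
    · exact absurd hvx (F.black_children_white x y)

theorem eq_of_not_elder {v w : Fin n} {x : Fin F.numBlack}
    (hv : F.parent (Sum.inl v) = some (Sum.inr x)) (hw : F.parent (Sum.inl w) = some (Sum.inr x))
    (hve : ¬ A.Elder v) (hwe : ¬ A.Elder w) : v = w := by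
  rw [h.elder_iff_of_black hv] at hve
  rw [h.elder_iff_of_black hw] at hwe
  push Not at hve hwe
  obtain ⟨i, hi⟩ := F.exists_parent_inr x
  refine leastDesc_inj A.acyclic ?_ (le_antisymm (hve w hw) (hwe v hv))
  rw [h.1, F.whiteParent_of_black hv hi, F.whiteParent_of_black hw hi]

theorem exists_not_elder (x : Fin F.numBlack) :
    ∃ w, F.parent (Sum.inl w) = some (Sum.inr x) ∧ ¬ A.Elder w := by
  obtain ⟨v, hv⟩ := F.exists_mem_cyc x
  obtain ⟨w, hw, hmin⟩ := Set.exists_min_image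
    {w | F.parent (Sum.inl w) = some (Sum.inr x)} A.least (Set.toFinite _)
    ⟨v, (F.mem_cyc x v).1 hv⟩
  refine ⟨w, hw, ?_⟩
  rw [h.elder_iff_of_black hw]
  push Not
  exact fun u hu => hmin u hu

/-- A young vertex at top level is sent to the root of its tree: itself, or its black father. This
is bijective since each black vertex has exactly one young child. -/
theorem tree_eq : F.tree = {w | ¬ A.Elder w ∧ A.parent w = none}.ncard := by
  symm
  have htop : ∀ w : Fin n, ∃ v : F.Vertex, F.parent v = (A.parent w).map Sum.inl ∧
      (v = Sum.inl w ∨ ∃ x, v = Sum.inr x ∧ F.parent (Sum.inl w) = some (Sum.inr x)) := by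
    intro w
    rw [h.1]
    rcases F.parent_cases w with h1 | ⟨x, h1, h2⟩
    · exact ⟨_, h1, Or.inl rfl⟩
    · exact ⟨_, h2, Or.inr ⟨x, rfl, h1⟩⟩
  choose g hg hg' using htop
  refine Set.ncard_congr (fun w _ => g w) ?_ ?_ ?_
  · rintro w ⟨_, hw⟩
    change F.parent (g w) = none
    rw [hg, hw]
    rfl
  · rintro v w ⟨hv, _⟩ ⟨hw, _⟩ hvw
    rcases hg' v with h1 | ⟨x, h1, h1'⟩ <;> rcases hg' w with h2 | ⟨y, h2, h2'⟩ <;>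
      rw [h1, h2] at hvw
    · exact Sum.inl_injective hvw
    · cases hvw
    · cases hvw
    · cases hvw
      exact h.eq_of_not_elder h1' h2' hv hw
  · rintro (w | x) hv
    · have hv : F.parent (Sum.inl w) = none := hv
      have hw : A.parent w = none := by
        rw [h.1]; exact F.whiteParent_of_white (i := none) hv
      refine ⟨w, ⟨h.not_elder_of_white (i := none) hv, hw⟩, ?_⟩
      rcases hg' w with h1 | ⟨x, _, h1⟩
      · exact h1
      · rw [hv] at h1; cases h1
    · have hv : F.parent (Sum.inr x) = none := hv
      obtain ⟨w, hw, hwe⟩ := h.exists_not_elder x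
      have hp : A.parent w = none := by
        rw [h.1]; exact F.whiteParent_of_black (i := none) hw hv
      refine ⟨w, ⟨hwe, hp⟩, ?_⟩
      rcases hg' w with h1 | ⟨y, h1, h2⟩
      · have := hg w
        rw [h1, hp, hw] at this
        cases this
      · rw [hw] at h2
        cases h2
        exact h1

theorem imp_eq : F.imp =
    {w | ¬ A.Elder w ∧ ∃ i, A.parent w = some i ∧ A.least w < i}.ncard := by
  symm
  have hpar : ∀ w i, A.parent w = some i → ∃ u, F.parent (Sum.inl w) = some u := by
    intro w i hw
    rcases F.parent_cases w with h1 | ⟨x, h1, _⟩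
    · rw [← h.1, hw] at h1
      exact ⟨_, h1⟩
    · exact ⟨_, h1⟩
  refine Set.ncard_congr
    -- The default of `getD` is never used: a vertex with a father in `A` has a white or black
    -- father in `F`.
    (fun w _ => ((F.parent (Sum.inl w)).getD (Sum.inl w), (Sum.inl w : F.Vertex))) ?_
    (fun v w _ _ hvw => Sum.inl_injective (Prod.mk.inj hvw).2) ?_
  · rintro w ⟨hwe, i, hi, hlt⟩
    change F.Improper _ _
    have hi' : F.whiteParent w = some i := by rw [← h.1, hi]
    rcases F.parent_cases w with h1 | ⟨x, h1, h2⟩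
    · rw [hi'] at h1
      left
      refine ⟨i, w, ?_, rfl, ?_, ?_⟩
      · rw [h1]; rfl
      · rw [h1]; exact h1
      · rw [h.beta_inl]; exact hlt
    · rw [hi'] at h2
      right
      refine ⟨x, i, ?_, (h.isRightmost_iff w x).2 ⟨h1, hwe⟩, ?_, ?_⟩
      · rw [h1]; rfl
      · rw [h1]; exact h2
      · rw [h.beta_inl]; exact hlt
  · rintro ⟨u, v⟩ (⟨i, j, hu, hv, hc, hlt⟩ | ⟨x, i, hu, hr, hc, hlt⟩) <;> dsimp only at *
    · subst hu hv
      have hc : F.parent (Sum.inl j) = some (Sum.inl i) := hc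
      rw [h.beta_inl] at hlt
      refine ⟨j, ⟨h.not_elder_of_white (i := some i) hc, i, ?_, hlt⟩, ?_⟩
      · rw [h.1]; exact F.whiteParent_of_white (i := some i) hc
      · rw [hc]; rfl
    · subst hu
      rcases v with w | y
      · obtain ⟨hw, hwe⟩ := (h.isRightmost_iff w x).1 hr
        rw [h.beta_inl] at hlt
        refine ⟨w, ⟨hwe, i, ?_, hlt⟩, ?_⟩
        · rw [h.1]; exact F.whiteParent_of_black (i := some i) hw hc
        · rw [hw]; rfl
      · exact absurd hr.1 (F.black_children_white x y)

/-- All children of a black vertex except the rightmost are elder, and white vertices without black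
father are never elder. -/
theorem bdeg_eq : F.bdeg = {w | A.Elder w}.ncard := by
  classical
  have hdeg : ∀ x, F.deg (Sum.inr x) - 1 =
      (Finset.univ.filter fun w => F.parent (Sum.inl w) = some (Sum.inr x) ∧ A.Elder w).card := by
    intro x
    obtain ⟨m, hm, hme⟩ := h.exists_not_elder x
    rw [show F.deg (Sum.inr x) = {w | F.parent (Sum.inl w) = some (Sum.inr x)}.ncard from
      F.ncard_children x, ← Set.ncard_sdiff_singleton_of_mem
        (show m ∈ {w | F.parent (Sum.inl w) = some (Sum.inr x)} from hm), ← Set.ncard_coe_finset]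
    congr 1
    ext w
    simp only [Finset.coe_filter, Finset.mem_univ, true_and, Set.mem_sdiff, Set.mem_ofPred_eq,
      Set.mem_singleton_iff]
    refine and_congr_right fun hw => ⟨fun hne => ?_, fun he hwm => hme (hwm ▸ he)⟩
    by_contra he
    exact hne (h.eq_of_not_elder hw hm he hme)
  unfold NamedHalfMobileForest.bdeg
  simp only [hdeg]
  rw [← Finset.card_biUnion, ← Set.ncard_coe_finset]
  · congr 1
    ext w
    simp only [Finset.coe_biUnion, Finset.mem_coe, Finset.mem_univ, Set.iUnion_true,
      Finset.coe_filter, true_and, Set.mem_iUnion, Set.mem_ofPred_eq]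
    constructor
    · rintro ⟨x, _, he⟩
      exact he
    · intro he
      rcases F.parent_cases w with h1 | ⟨x, h1, _⟩
      · exact absurd he (h.not_elder_of_white h1)
      · exact ⟨x, h1, he⟩
  · intro x _ y _ hxy
    rw [Function.onFun, Finset.disjoint_left]
    intro w hw hw'
    simp only [Finset.mem_filter, Finset.mem_univ, true_and] at hw hw'
    have := hw.1.symm.trans hw'.1
    simp only [Option.some.injEq, Sum.inr.injEq] at this
    exact hxy this

omit h in
theorem of_isIso (h : A.Matches F) {G : NamedHalfMobileForest n}
    {e : Fin F.numBlack ≃ Fin G.numBlack} (he : NamedHalfMobileForest.IsIso F G e) :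
    A.Matches G := by
  refine ⟨h.1.trans he.whiteParent_eq, fun i => ?_⟩
  obtain ⟨bs, h1, h2, h3⟩ := h.2 i
  exact ⟨bs, h1, h2, fun c => Iff.trans ⟨he.symm.isCircle, he.isCircle⟩ (h3 c)⟩

end Matches

variable {n : ℕ}

/-- The half-mobile forest of an ordered forest. -/
noncomputable def toHalfMobile (A : OrderedForest n) : HalfMobileForest n :=
  Quotient.mk (NamedHalfMobileForest.setoid n) A.exists_named_of_ordered.choose

theorem toHalfMobile_bijective : Function.Bijective (toHalfMobile (n := n)) := by
  constructor
  · intro A B hAB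
    have hA := A.exists_named_of_ordered.choose_spec
    have hB := B.exists_named_of_ordered.choose_spec
    obtain ⟨e, he⟩ := Quotient.exact hAB
    exact (hA.of_isIso he).eq hB
  · intro F
    induction F using Quotient.inductionOn with
    | _ F =>
      obtain ⟨A, hA⟩ := exists_matches_of_named F
      exact ⟨A, Quotient.sound (s := NamedHalfMobileForest.setoid n)
        (A.exists_named_of_ordered.choose_spec.equiv hA)⟩

theorem tree_toHalfMobile (A : OrderedForest n) :
    A.toHalfMobile.tree = {w | ¬ A.Elder w ∧ A.parent w = none}.ncard :=
  A.exists_named_of_ordered.choose_spec.tree_eq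

theorem imp_toHalfMobile (A : OrderedForest n) : A.toHalfMobile.imp =
    {w | ¬ A.Elder w ∧ ∃ i, A.parent w = some i ∧ A.least w < i}.ncard :=
  A.exists_named_of_ordered.choose_spec.imp_eq

theorem bdeg_toHalfMobile (A : OrderedForest n) :
    A.toHalfMobile.bdeg = {w | A.Elder w}.ncard :=
  A.exists_named_of_ordered.choose_spec.bdeg_eq

/-- The root with the smallest β is young. This makes the subtraction in `tree - 1` genuine. -/
theorem exists_young_root (A : OrderedForest n) (hn : 1 ≤ n) :
    1 ≤ {w | ¬ A.Elder w ∧ A.parent w = none}.ncard := by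
  obtain ⟨r, -, hr⟩ := (father_wellFounded A.acyclic).has_min Set.univ ⟨⟨0, hn⟩, trivial⟩
  have hr : A.parent r = none := by
    cases hp : A.parent r with
    | none => rfl
    | some u => exact absurd hp (hr u trivial)
  obtain ⟨w, hw, hmin⟩ := Set.exists_min_image {w | A.parent w = none} A.least
    (Set.toFinite _) ⟨r, hr⟩
  have hw : A.parent w = none := hw
  rw [Nat.one_le_iff_ne_zero, ← Nat.pos_iff_ne_zero, Set.ncard_pos]
  refine ⟨w, ?_, hw⟩
  rintro ⟨k, hs, hk⟩
  have hk' : k ∈ A.children (A.parent w) := hs.subset (by simp)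
  rw [A.mem_children, hw] at hk'
  exact absurd hk (not_lt.2 (hmin k hk'))

/-- Ordered forests and half-mobile forests correspond to each other. -/
noncomputable def equivHalfMobile (n : ℕ) : OrderedForest n ≃ HalfMobileForest n :=
  Equiv.ofBijective toHalfMobile toHalfMobile_bijective

noncomputable instance : Fintype (OrderedForest n) := Fintype.ofFinite _

theorem sum_weight_toLabeled : ∑ A : OrderedForest n, LabeledForest.weight none A.toLabeled
    = ((LabeledForest.all n).map (LabeledForest.weight none)).sum := by
  classical
  rw [← List.sum_toFinset _ (LabeledForest.nodup_all n)]
  refine Finset.sum_bij (fun A _ => A.toLabeled) ?_ (fun A _ B _ h => toLabeled_injective h) ?_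
    fun _ _ => rfl
  · intro A _
    rw [List.mem_toFinset, toLabeled_mem_all]
    exact ⟨A, rfl⟩
  · intro F hF
    rw [List.mem_toFinset, toLabeled_mem_all] at hF
    obtain ⟨A, hA⟩ := hF
    exact ⟨A, Finset.mem_univ _, hA⟩

end OrderedForest

/-! ### The generating function of half-mobile forests -/

namespace HalfMobileForest

variable {n : ℕ}

theorem one_le_tree (F : HalfMobileForest n) (hn : 1 ≤ n) : 1 ≤ F.tree := by
  obtain ⟨A, rfl⟩ := OrderedForest.toHalfMobile_bijective.2 F
  rw [A.tree_toHalfMobile]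
  exact A.exists_young_root hn

/-- After multiplication by `X 0` both sides are the total weight of all ordered forests:
`one_le_tree` restores the exponent, and the factor cancels in the polynomial ring. -/
theorem sum_monomial (hn : 1 ≤ n) : chapotonQOne n = ∑ F : HalfMobileForest n,
    (X 0 ^ (F.tree - 1) * X 1 ^ F.imp * X 2 ^ F.bdeg : MvPolynomial (Fin 3) ℤ) := by
  refine mul_left_cancel₀ (X_ne_zero (0 : Fin 3)) ?_
  obtain ⟨m, rfl⟩ := Nat.exists_eq_add_of_le' hn
  rw [← LabeledForest.sum_weight_all, ← OrderedForest.sum_weight_toLabeled, Finset.mul_sum,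
    ← (OrderedForest.equivHalfMobile (m + 1)).sum_comp]
  refine Finset.sum_congr rfl fun A _ => ?_
  have h1 := (A.toHalfMobile).one_le_tree hn
  change _ = X 0 * (X 0 ^ (A.toHalfMobile.tree - 1) * X 1 ^ A.toHalfMobile.imp *
    X 2 ^ A.toHalfMobile.bdeg)
  rw [← mul_assoc, ← mul_assoc, ← pow_succ', Nat.sub_add_cancel h1, A.weight_toLabeled,
    A.tree_toHalfMobile, A.imp_toHalfMobile, A.bdeg_toHalfMobile]

end HalfMobileForest

theorem chapotonQCoeff_eq_coeff (n k : ℕ) : chapotonQCoeff n k =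
    (aeval (![Polynomial.C (X 0), Polynomial.X, Polynomial.C (X 1)] :
      Fin 3 → Polynomial (MvPolynomial (Fin 2) ℤ)) (chapotonQOne n)).coeff k := by
  unfold chapotonQCoeff chapotonQOne
  rw [← AlgHom.comp_apply]
  congr 2
  refine MvPolynomial.algHom_ext fun i => ?_
  fin_cases i <;> simp

theorem theorem3p3 (n : ℕ) (hn : 1 ≤ n) :
    (∃ θ : {T : PlaneTree (n + 1) // T.root = 0} ≃ HalfMobileForest n,
      ∀ T : {T : PlaneTree (n + 1) // T.root = 0},
        T.1.young 0 = (θ T).tree ∧ T.1.eld = (θ T).bdeg ∧ T.1.imp = (θ T).imp) ∧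
    (∀ k : ℕ, chapotonQCoeff n k =
      ∑ F : HalfMobileForest n with F.imp = k,
        (X 0 ^ (F.tree - 1) * X 1 ^ F.bdeg : MvPolynomial (Fin 2) ℤ)) ∧
    chapotonQOne n =
      ∑ F : HalfMobileForest n,
        (X 0 ^ (F.tree - 1) * X 1 ^ F.imp * X 2 ^ F.bdeg : MvPolynomial (Fin 3) ℤ) := by
  refine ⟨⟨(OrderedForest.equivPlaneTree n).symm.trans (OrderedForest.equivHalfMobile n), ?_⟩,
    fun k => ?_, HalfMobileForest.sum_monomial hn⟩
  · intro T
    obtain ⟨A, rfl⟩ := (OrderedForest.equivPlaneTree n).surjective T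
    rw [Equiv.trans_apply, Equiv.symm_apply_apply]
    exact ⟨A.toPlaneTree_young.trans A.tree_toHalfMobile.symm,
      A.toPlaneTree_eld.trans A.bdeg_toHalfMobile.symm,
      A.toPlaneTree_imp.trans A.imp_toHalfMobile.symm⟩
  · rw [chapotonQCoeff_eq_coeff, HalfMobileForest.sum_monomial hn, map_sum,
      Polynomial.finsetSum_coeff, Finset.sum_filter]
    refine Finset.sum_congr rfl fun F _ => ?_
    have h1 : aeval (![Polynomial.C (X 0), Polynomial.X, Polynomial.C (X 1)] :
        Fin 3 → Polynomial (MvPolynomial (Fin 2) ℤ))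
        (X 0 ^ (F.tree - 1) * X 1 ^ F.imp * X 2 ^ F.bdeg : MvPolynomial (Fin 3) ℤ)
        = Polynomial.C (X 0 ^ (F.tree - 1) * X 1 ^ F.bdeg) * Polynomial.X ^ F.imp := by
      simp
      ring
    rw [h1, Polynomial.coeff_C_mul_X_pow]
    simp only [eq_comm]
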